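/- Let $(M,g)$ be a nonempty smooth Riemannian manifold of dimension $n\ge 2$ with constant sectional curvature $c>0$, and let $T^*_0M$ be its cotangent bundle with the zero section removed. In a chart $(x^i)$ of $M$ and the induced chart $(q^i,p_i)$ of $T^*_0M$ put $t=\tfrac12 g^{ik}p_ip_k$, $g^{0i}=g^{hi}p_h$, $\Gamma^0_{ij}=p_k\Gamma^k_{ij}$ (with $\Gamma^k_{ij}$ the Christoffel symbols of $g$), $\frac{\delta}{\delta q^i}=\frac{\partial}{\partial q^i}+\Gamma^0_{ih}\frac{\partial}{\partial p_h}$ and $Dp_i=dp_i-\Gamma^0_{ij}dq^j$ (summation convention). Let $b_1,\lambda,\mu:(0,\infty)\to\mathbb R$ be smooth functions such that, for all $t>0$, $$b_1(t)>-\sqrt{\tfrac{c}{2t}},\qquad \lambda(t)>0,\qquad \lambda(t)+2t\mu(t)>0 .$$ Let $J$ be the endomorphism field with $J\frac{\delta}{\delta q^i}=J^{(1)}_{ij}\frac{\partial}{\partial p_j}$, $J\frac{\partial}{\partial p_i}=-J_{(2)}^{ij}\frac{\delta}{\delta q^j}$, where $$J^{(1)}_{ij}=\sqrt{2ct}\,g_{ij}+b_1p_ip_j,\qquad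 J_{(2)}^{ij}=\frac{1}{\sqrt{2ct}}g^{ij}-\frac{b_1}{2\sqrt c\,t(\sqrt c+\sqrt{2t}\,b_1)}g^{0i}g^{0j},$$ and let $G=G^{(1)}_{ij}dq^idq^j+G_{(2)}^{ij}Dp_iDp_j$, where $$G^{(1)}_{ij}=\sqrt{2ct}\,\lambda\, g_{ij}+\bigl(b_1\lambda+\sqrt{2t}(\sqrt c+\sqrt{2t}\,b_1)\mu\bigr)p_ip_j,\qquad G_{(2)}^{ij}=\frac{\lambda}{\sqrt{2ct}}g^{ij}+\frac{-b_1\lambda+\sqrt{2ct}\,\mu}{2\sqrt c\,t(\sqrt c+\sqrt{2t}\,b_1)}g^{0i}g^{0j},$$ with $b_1,\lambda,\mu$ evaluated at $t$. Then $(G,J)$ is a Hermitian structure on $T^*_0M$ (that is, $G$ is a Riemannian metric, $J$ is an almost complex structure with vanishing Nijenhuis tensor, and $G(JX,JY)=G(X,Y)$); its fundamental 2-form $\phi(X,Y)=G(X,JY)$ is $$\phi=(\lambda\delta^i_j+\mu g^{0i}p_j)\,Dp_i\wedge dq^j ;$$ and $(G,J)$ is Kähler (that is, Hermitian with $d\phi=0$)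 if and only if $\mu=\lambda'$ on $(0,\infty)$. -/

import Mathlib

open scoped Manifold ContDiff Matrix

noncomputable section

namespace NaturalCotangent

/-! ### Local Riemannian geometry in coordinates `q = (q¹, …, qⁿ)`

Here `g q` is the matrix `(g_ij(q))` of a Riemannian metric in some chart. -/

/-- Coordinate space of an `n`-dimensional manifold. -/
abbrev Coord (n : ℕ) : Type := EuclideanSpace ℝ (Fin n)

/-- The `i`-th vector of the standard basis of the coordinate space. -/
def stdVec {n : ℕ} (i : Fin n) : Coord n := EuclideanSpace.single i (1 : ℝ)

/-- The partial derivative `∂f/∂qⁱ`. -/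
def pderiv {n : ℕ} (i : Fin n) (f : Coord n → ℝ) (q : Coord n) : ℝ :=
  fderiv ℝ f q (stdVec i)

/-- The Christoffel symbol `Γ^k_{ih}` of the metric with components `g`. -/
def christoffel {n : ℕ} (g : Coord n → Matrix (Fin n) (Fin n) ℝ) (k i h : Fin n)
    (q : Coord n) : ℝ :=
  (1 / 2) * ∑ l, (g q)⁻¹ k l *
    (pderiv i (fun x => g x l h) q + pderiv h (fun x => g x i l) q
      - pderiv l (fun x => g x i h) q)

/-- The component `R^h_{kij}` of the curvature tensor, where
`R(∂_i, ∂_j) ∂_k = ∇_i ∇_j ∂_k - ∇_j ∇_i ∂_k = ∑ R^h_{kij} ∂_h`. -/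
def curvature {n : ℕ} (g : Coord n → Matrix (Fin n) (Fin n) ℝ) (h k i j : Fin n)
    (q : Coord n) : ℝ :=
  pderiv i (christoffel g h j k) q - pderiv j (christoffel g h i k) q
    + ∑ l, (christoffel g h i l q * christoffel g l j k q
      - christoffel g h j l q * christoffel g l i k q)

/-- The scalar product `g(u, v)` at `q`. -/
def scalarProd {n : ℕ} (g : Coord n → Matrix (Fin n) (Fin n) ℝ) (q : Coord n)
    (u v : Fin n → ℝ) : ℝ :=
  ∑ i, ∑ j, g q i j * u i * v j

/-- The vector `R(u, v) w` at `q`. -/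
def curvatureVec {n : ℕ} (g : Coord n → Matrix (Fin n) (Fin n) ℝ) (q : Coord n)
    (u v w : Fin n → ℝ) : Fin n → ℝ :=
  fun h => ∑ k, ∑ i, ∑ j, curvature g h k i j q * w k * u i * v j

/-- The sectional curvature at `q` of the plane spanned by `u` and `v`. -/
def sectionalCurvature {n : ℕ} (g : Coord n → Matrix (Fin n) (Fin n) ℝ) (q : Coord n)
    (u v : Fin n → ℝ) : ℝ :=
  scalarProd g q (curvatureVec g q u v v) u /
    (scalarProd g q u u * scalarProd g q v v - scalarProd g q u v ^ 2)

/-! ### The cotangent bundle in coordinates `(q, p) = (q¹, …, qⁿ, p₁, …, pₙ)` -/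

/-- Coordinate space of the cotangent bundle of an `n`-dimensional manifold. -/
abbrev PhaseCoord (n : ℕ) : Type := Coord n × Coord n

/-- The energy density `t = ½ g^{ik}(q) p_i p_k`. -/
def energy {n : ℕ} (g : Coord n → Matrix (Fin n) (Fin n) ℝ) (y : PhaseCoord n) : ℝ :=
  (1 / 2) * ∑ i, ∑ k, (g y.1)⁻¹ i k * y.2 i * y.2 k

/-- `g^{0i} = p_h g^{hi}`. -/
def raised {n : ℕ} (g : Coord n → Matrix (Fin n) (Fin n) ℝ) (y : PhaseCoord n)
    (i : Fin n) : ℝ :=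
  ∑ h, y.2 h * (g y.1)⁻¹ h i

/-- `Γ^0_{ih} = p_k Γ^k_{ih}`. -/
def christoffelZero {n : ℕ} (g : Coord n → Matrix (Fin n) (Fin n) ℝ) (y : PhaseCoord n)
    (i h : Fin n) : ℝ :=
  ∑ k, y.2 k * christoffel g k i h y.1

/-- The vertical vector field `∂/∂p_i`. -/
def vert {n : ℕ} (i : Fin n) : PhaseCoord n := (0, stdVec i)

/-- The horizontal vector field `δ/δqⁱ = ∂/∂qⁱ + Γ^0_{ih} ∂/∂p_h`. -/
def horiz {n : ℕ} (g : Coord n → Matrix (Fin n) (Fin n) ℝ) (y : PhaseCoord n)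
    (i : Fin n) : PhaseCoord n :=
  ((stdVec i, 0) : PhaseCoord n) + ∑ h, christoffelZero g y i h • vert h

/-- The coordinate 1-form `dqⁱ`. -/
def dq {n : ℕ} (i : Fin n) : PhaseCoord n →L[ℝ] ℝ :=
  (EuclideanSpace.proj i : Coord n →L[ℝ] ℝ) ∘L ContinuousLinearMap.fst ℝ (Coord n) (Coord n)

/-- The coordinate 1-form `dp_i`. -/
def dp {n : ℕ} (i : Fin n) : PhaseCoord n →L[ℝ] ℝ :=
  (EuclideanSpace.proj i : Coord n →L[ℝ] ℝ) ∘L ContinuousLinearMap.snd ℝ (Coord n) (Coord n)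

/-- The absolute differential `Dp_i = dp_i - Γ^0_{ij} dqʲ`. -/
def Dp {n : ℕ} (g : Coord n → Matrix (Fin n) (Fin n) ℝ) (y : PhaseCoord n)
    (i : Fin n) : PhaseCoord n →L[ℝ] ℝ :=
  dp i - ∑ j, christoffelZero g y i j • dq j

/-- `J^{(1)}_{ij} = √(2ct) g_ij + b₁ p_i p_j`. -/
def J1 {n : ℕ} (c : ℝ) (b₁ : ℝ → ℝ) (g : Coord n → Matrix (Fin n) (Fin n) ℝ)
    (y : PhaseCoord n) (i j : Fin n) : ℝ :=
  √(2 * c * energy g y) * g y.1 i j + b₁ (energy g y) * y.2 i * y.2 j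

/-- `J_{(2)}^{ij} = (1/√(2ct)) g^{ij} - b₁ / (2 √c t (√c + √(2t) b₁)) g^{0i} g^{0j}`. -/
def J2 {n : ℕ} (c : ℝ) (b₁ : ℝ → ℝ) (g : Coord n → Matrix (Fin n) (Fin n) ℝ)
    (y : PhaseCoord n) (i j : Fin n) : ℝ :=
  1 / √(2 * c * energy g y) * (g y.1)⁻¹ i j
    - b₁ (energy g y) / (2 * √c * energy g y * (√c + √(2 * energy g y) * b₁ (energy g y)))
      * raised g y i * raised g y j

/-- The natural almost complex structure of diagonal type: the endomorphism with
`J (δ/δqⁱ) = J^{(1)}_{ij} ∂/∂p_j` and `J (∂/∂p_i) = - J_{(2)}^{ij} δ/δqʲ`. -/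
def J {n : ℕ} (c : ℝ) (b₁ : ℝ → ℝ) (g : Coord n → Matrix (Fin n) (Fin n) ℝ)
    (y : PhaseCoord n) : PhaseCoord n →L[ℝ] PhaseCoord n :=
  (∑ i, ∑ j, J1 c b₁ g y i j • (dq i).smulRight (vert j))
    - ∑ i, ∑ j, J2 c b₁ g y i j • (Dp g y i).smulRight (horiz g y j)

/-- The coefficient `c₁ = √(2ct) λ`. -/
def coefC1 (c : ℝ) (lam : ℝ → ℝ) (t : ℝ) : ℝ := √(2 * c * t) * lam t

/-- The coefficient `c₂ = λ / √(2ct)`. -/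
def coefC2 (c : ℝ) (lam : ℝ → ℝ) (t : ℝ) : ℝ := lam t / √(2 * c * t)

/-- The coefficient `d₁ = b₁ λ + √(2t) (√c + √(2t) b₁) μ`. -/
def coefD1 (c : ℝ) (b₁ lam mu : ℝ → ℝ) (t : ℝ) : ℝ :=
  b₁ t * lam t + √(2 * t) * (√c + √(2 * t) * b₁ t) * mu t

/-- The coefficient `d₂ = (- b₁ λ + √(2ct) μ) / (2 √c t (√c + √(2t) b₁))`. -/
def coefD2 (c : ℝ) (b₁ lam mu : ℝ → ℝ) (t : ℝ) : ℝ :=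
  (-(b₁ t * lam t) + √(2 * c * t) * mu t) / (2 * √c * t * (√c + √(2 * t) * b₁ t))

/-- `G^{(1)}_{ij} = c₁ g_ij + d₁ p_i p_j`. -/
def G1 {n : ℕ} (c : ℝ) (b₁ lam mu : ℝ → ℝ) (g : Coord n → Matrix (Fin n) (Fin n) ℝ)
    (y : PhaseCoord n) (i j : Fin n) : ℝ :=
  coefC1 c lam (energy g y) * g y.1 i j + coefD1 c b₁ lam mu (energy g y) * y.2 i * y.2 j

/-- `G_{(2)}^{ij} = c₂ g^{ij} + d₂ g^{0i} g^{0j}`. -/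
def G2 {n : ℕ} (c : ℝ) (b₁ lam mu : ℝ → ℝ) (g : Coord n → Matrix (Fin n) (Fin n) ℝ)
    (y : PhaseCoord n) (i j : Fin n) : ℝ :=
  coefC2 c lam (energy g y) * (g y.1)⁻¹ i j
    + coefD2 c b₁ lam mu (energy g y) * raised g y i * raised g y j

/-- The natural metric of diagonal type
`G = G^{(1)}_{ij} dqⁱ dqʲ + G_{(2)}^{ij} Dp_i Dp_j`. -/
def G {n : ℕ} (c : ℝ) (b₁ lam mu : ℝ → ℝ) (g : Coord n → Matrix (Fin n) (Fin n) ℝ)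
    (y : PhaseCoord n) : PhaseCoord n →L[ℝ] PhaseCoord n →L[ℝ] ℝ :=
  (∑ i, ∑ j, G1 c b₁ lam mu g y i j • (dq i).smulRight (dq j : PhaseCoord n →L[ℝ] ℝ))
    + ∑ i, ∑ j, G2 c b₁ lam mu g y i j • (Dp g y i).smulRight (Dp g y j)

/-! ### Hermitian and Kähler structures on an open set of a normed space -/

section Structures

variable {E : Type*} [NormedAddCommGroup E] [NormedSpace ℝ E]

/-- The Nijenhuis tensor `N(X, Y) = [JX, JY] - J[JX, Y] - J[X, JY] - [X, Y]`. -/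
def nijenhuis (J : E → E →L[ℝ] E) (X Y : E → E) (y : E) : E :=
  VectorField.lieBracket ℝ (fun z => J z (X z)) (fun z => J z (Y z)) y
    - J y (VectorField.lieBracket ℝ (fun z => J z (X z)) Y y)
    - J y (VectorField.lieBracket ℝ X (fun z => J z (Y z)) y)
    - VectorField.lieBracket ℝ X Y y

/-- `(G, J)` is a Hermitian structure on the open set `Ω`: `G` is a smooth Riemannian metric,
`J` is a smooth integrable almost complex structure and `G(JX, JY) = G(X, Y)`. -/
structure IsHermitianOn (Ω : Set E) (G : E → E →L[ℝ] E →L[ℝ] ℝ) (J : E → E →L[ℝ] E) :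
    Prop where
  smooth_metric : ContDiffOn ℝ ∞ G Ω
  symm : ∀ y ∈ Ω, ∀ X Y, G y X Y = G y Y X
  pos : ∀ y ∈ Ω, ∀ X, X ≠ 0 → 0 < G y X X
  smooth_complex : ContDiffOn ℝ ∞ J Ω
  sq_eq_neg_one : ∀ y ∈ Ω, ∀ X, J y (J y X) = -X
  integrable : ∀ X Y : E → E, ContDiffOn ℝ ∞ X Ω → ContDiffOn ℝ ∞ Y Ω →
    ∀ y ∈ Ω, nijenhuis J X Y y = 0
  compatible : ∀ y ∈ Ω, ∀ X Y, G y (J y X) (J y Y) = G y X Y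

/-- The fundamental form `φ(X, Y) = G(X, JY)`. -/
def fundamentalForm (G : E → E →L[ℝ] E →L[ℝ] ℝ) (J : E → E →L[ℝ] E) (y X Y : E) : ℝ :=
  G y X (J y Y)

/-- `φ` is, on the open set `Ω`, a smooth differential 2-form with `dφ = 0`. -/
def IsClosedTwoFormOn (Ω : Set E) (φ : E → E → E → ℝ) : Prop :=
  ∃ η : E → E [⋀^Fin 2]→L[ℝ] ℝ, ContDiffOn ℝ ∞ η Ω ∧
    (∀ y ∈ Ω, ∀ X Y, η y ![X, Y] = φ y X Y) ∧ ∀ y ∈ Ω, extDeriv η y = 0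

end Structures

/-! ### The manifold, its charts and the induced charts of the nonzero cotangent bundle -/

section Manifold

variable {n : ℕ} {M : Type*} [TopologicalSpace M] [ChartedSpace (Coord n) M]

/-- The coordinate vector `∂/∂xⁱ` of the chart `e` at the point with coordinates `q`. -/
def chartVec (e : OpenPartialHomeomorph M (Coord n)) (q : Coord n) (i : Fin n) :
    TangentSpace (𝓡 n) (e.symm q) :=
  mfderiv (𝓡 n) (𝓡 n) e.symm q (stdVec i)

/-- The nonzero cotangent bundle `T*₀M`: the nonzero covectors of `M`. -/
abbrev NonzeroCotangent (n : ℕ) (M : Type*) [TopologicalSpace M] [ChartedSpace (Coord n) M] :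
    Type _ :=
  {P : Bundle.TotalSpace (Coord n →L[ℝ] ℝ)
    (fun x : M => TangentSpace (𝓡 n) x →L[ℝ] ℝ) // P.snd ≠ 0}

/-- The induced chart of `T*₀M`: a covector `P = p_i dxⁱ` at `x` has the coordinates `(q, p)`,
where `q = e x` and `p_i = P (∂/∂xⁱ)`. -/
def inducedChart (e : OpenPartialHomeomorph M (Coord n)) (P : NonzeroCotangent n M) :
    PhaseCoord n :=
  (e P.1.proj, WithLp.toLp 2 fun i =>
    P.1.snd (mfderiv (𝓡 n) (𝓡 n) e.symm (e P.1.proj) (stdVec i)))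

/-- The range of the induced chart, i.e. the image of the nonzero covectors over `e.source`. -/
def inducedTarget (e : OpenPartialHomeomorph M (Coord n)) : Set (PhaseCoord n) :=
  inducedChart e '' {P | P.1.proj ∈ e.source}

/-- The range of the induced chart consists of all `(q, p)` with `q ∈ e.target` and `p ≠ 0`. -/
theorem mem_inducedTarget {e : OpenPartialHomeomorph M (Coord n)}
    (he : e ∈ IsManifold.maximalAtlas (𝓡 n) ∞ M) (y : PhaseCoord n) :
    y ∈ inducedTarget e ↔ y.1 ∈ e.target ∧ y.2 ≠ 0 := by
  have he1 : e ∈ IsManifold.maximalAtlas (𝓡 n) 1 M :=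
    IsManifold.maximalAtlas_subset_of_le (by norm_num) he
  have hM : e.MDifferentiable (𝓡 n) (𝓡 n) :=
    ⟨fun z hz => (mdifferentiableAt_of_mem_maximalAtlas he1 hz).mdifferentiableWithinAt,
      fun z hz => (mdifferentiableAt_symm_of_mem_maximalAtlas he1 hz).mdifferentiableWithinAt⟩
  constructor
  · rintro ⟨P, hP, rfl⟩
    have hP' : P.1.proj ∈ e.source := hP
    refine ⟨e.map_source hP, fun h0 => P.2 ?_⟩
    have hz : ∀ i, P.1.snd (mfderiv (𝓡 n) (𝓡 n) e.symm (e P.1.proj) (stdVec i)) = 0 := by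
      intro i
      have := congrArg (fun v : Coord n => v i) h0
      simpa [inducedChart] using this
    let B : Coord n →L[ℝ] ℝ := (P.1.snd : Coord n →L[ℝ] ℝ).comp
      (mfderiv (𝓡 n) (𝓡 n) e.symm (e P.1.proj) : Coord n →L[ℝ] Coord n)
    have hlin : ∀ v : Coord n,
        P.1.snd (mfderiv (𝓡 n) (𝓡 n) e.symm (e P.1.proj) v) = 0 := by
      intro v
      have hv : v = ∑ i, v i • stdVec i := by
        ext k
        simp [stdVec, Pi.single_apply]
      rw [hv]
      have hB := fun i => (show B (stdVec i) = 0 from hz i)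
      change B (∑ i, v i • stdVec i) = 0
      simp [map_sum, hB]
    ext w
    have h := hlin (mfderiv (𝓡 n) (𝓡 n) e P.1.proj w)
    have hc := congrArg (fun L => L w) (hM.symm_comp_deriv hP')
    exact (congrArg P.1.snd hc).symm.trans h
  · rintro ⟨hy, hp⟩
    let L : TangentSpace (𝓡 n) (e.symm y.1) →L[ℝ] ℝ :=
      (∑ i, y.2 i • (EuclideanSpace.proj i : Coord n →L[ℝ] ℝ)).comp
        (mfderiv (𝓡 n) (𝓡 n) e (e.symm y.1))
    have hL : ∀ i, L (mfderiv (𝓡 n) (𝓡 n) e.symm (e (e.symm y.1)) (stdVec i)) = y.2 i := by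
      intro i
      have hc := congrArg (fun A => A (stdVec i)) (hM.comp_symm_deriv hy)
      have hc' : mfderiv (𝓡 n) (𝓡 n) e (e.symm y.1)
          (mfderiv (𝓡 n) (𝓡 n) e.symm (e (e.symm y.1)) (stdVec i)) = stdVec i := by
        rw [e.right_inv hy]; exact hc
      have : L (mfderiv (𝓡 n) (𝓡 n) e.symm (e (e.symm y.1)) (stdVec i)) =
          (∑ k, y.2 k • (EuclideanSpace.proj k : Coord n →L[ℝ] ℝ)) (stdVec i) :=
        congrArg (fun v => (∑ k, y.2 k • (EuclideanSpace.proj k : Coord n →L[ℝ] ℝ)) v) hc'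
      rw [this]
      simp [stdVec, PiLp.single_apply]
    refine ⟨⟨⟨e.symm y.1, L⟩, fun h0 => hp ?_⟩, e.map_target hy, ?_⟩
    · ext i
      rw [← hL i]
      exact congrArg (fun A => A (mfderiv (𝓡 n) (𝓡 n) e.symm (e (e.symm y.1)) (stdVec i))) h0
    · refine Prod.ext (e.right_inv hy) ?_
      ext i
      exact hL i

variable [IsManifold (𝓡 n) ∞ M]

/-- The components `g_ij(q) = g(∂/∂xⁱ, ∂/∂xʲ)` of the metric in the chart `e`. -/
def metricMatrix
    (g : Bundle.ContMDiffRiemannianMetric (𝓡 n) ∞ (Coord n)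
      (fun x : M => TangentSpace (𝓡 n) x))
    (e : OpenPartialHomeomorph M (Coord n)) (q : Coord n) : Matrix (Fin n) (Fin n) ℝ :=
  Matrix.of fun i j => g.inner (e.symm q) (chartVec e q i) (chartVec e q j)

/-- `(M, g)` has constant sectional curvature `c`. -/
def HasConstantSectionalCurvature
    (g : Bundle.ContMDiffRiemannianMetric (𝓡 n) ∞ (Coord n)
      (fun x : M => TangentSpace (𝓡 n) x)) (c : ℝ) : Prop :=
  ∀ e ∈ IsManifold.maximalAtlas (𝓡 n) ∞ M, ∀ q ∈ e.target, ∀ u v : Fin n → ℝ,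
    LinearIndependent ℝ ![u, v] → sectionalCurvature (metricMatrix g e) q u v = c

/-- The pair `(G, J)` with parameters `b₁, λ, μ` is a Hermitian structure on `T*₀M`
(expressed in all induced charts). -/
def IsHermitian
    (g : Bundle.ContMDiffRiemannianMetric (𝓡 n) ∞ (Coord n)
      (fun x : M => TangentSpace (𝓡 n) x)) (c : ℝ) (b₁ lam mu : ℝ → ℝ) : Prop :=
  ∀ e ∈ IsManifold.maximalAtlas (𝓡 n) ∞ M,
    IsHermitianOn (inducedTarget e) (G c b₁ lam mu (metricMatrix g e))
      (J c b₁ (metricMatrix g e))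

/-- The pair `(G, J)` with parameters `b₁, λ, μ` is a Kähler structure on `T*₀M`: it is
Hermitian and its fundamental 2-form is closed. -/
def IsKaehler
    (g : Bundle.ContMDiffRiemannianMetric (𝓡 n) ∞ (Coord n)
      (fun x : M => TangentSpace (𝓡 n) x)) (c : ℝ) (b₁ lam mu : ℝ → ℝ) : Prop :=
  IsHermitian g c b₁ lam mu ∧
  ∀ e ∈ IsManifold.maximalAtlas (𝓡 n) ∞ M,
    IsClosedTwoFormOn (inducedTarget e)
      (fundamentalForm (G c b₁ lam mu (metricMatrix g e)) (J c b₁ (metricMatrix g e)))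

end Manifold

end NaturalCotangent

end

noncomputable section

namespace NaturalCotangent

open Topology

/-! ### Components of the metric in a chart. -/

section Charts

variable {n : ℕ} {M : Type*} [TopologicalSpace M] [ChartedSpace (Coord n) M]
  [IsManifold (𝓡 n) ∞ M]

/-! Everything is computed in an induced chart, with tangent vectors split along the frame `δ/δqⁱ`,
`∂/∂p_i` dual to `dqⁱ`, `Dp_i`. In this frame `J` is the block matrix with off-diagonal blocks `-J₂`
and `J₁`, and `G` has diagonal blocks `G₁`, `G₂`. All the algebra follows from three matrix
identities: `J₁ J₂ = 1`, `G₁ = J₁ F` and `G₂ = F J₂`, where `F = λ 1 + μ g^{0i} p_j`. They give `J²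
= -1`, compatibility, and that `F` is the matrix of `φ`. Each block of `G` is a rank-one
perturbation of a multiple of `g` or `g⁻¹`, so positivity is a Cauchy–Schwarz estimate
(`quadratic_pos`).

For integrability, the Nijenhuis tensor is tensorial and satisfies `N(JX, Y) = -J N(X, Y)`, so only
`N(δ_i, δ_j)` matters (`nijenhuis_eq_zero_of_frame`). Its mixed brackets cancel because `J₁` is
parallel along horizontal directions and the connection is torsion-free. What remains is `[Jδ_i,
Jδ_j] = [δ_i, δ_j]`. The right side is the curvature contracted with `p`, which for constant
curvature has vertical components `c (p_i g_jl - p_j g_il)`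
(`IsMetricOn.fderiv_christoffelZero_horiz_sub`). The left side gives the same because the
coefficient `√(2ct)` of `g` in `J₁` has square `2ct`; the function `b₁` drops out
(`sum_J1_mul_fderiv_J1_sub`). The form of the curvature tensor is obtained from the sectional
curvatures by polarization (`curvatureLike_eq_zero`).

For the Kähler condition let `θ = p_i dqⁱ`. Since `Γ^0_{ij}` is symmetric and `dt = g^{0i} Dp_i`,
one gets `φ = λ dθ + μ dt ∧ θ` (`fundamentalForm_eq_symplecticForm`). If `μ = λ'` this is `d(λθ)`.
Conversely, subtracting `d(Fθ)` with `F' = μ` leaves `(λ - F) dθ`, whose closedness means `(λ' - μ)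
dt ∧ dθ = 0`; as `n ≥ 2`, `dt ∧ dθ` does not vanish (`mu_eq_deriv_lam`). -/

theorem contMDiffOn_chartVec {e : OpenPartialHomeomorph M (Coord n)}
    (he : e ∈ IsManifold.maximalAtlas (𝓡 n) ∞ M) (i : Fin n) :
    ContMDiffOn (𝓡 n) (𝓡 n).tangent ∞
      (fun q => (⟨e.symm q, chartVec e q i⟩ : TangentBundle (𝓡 n) M)) e.target := by
  have hs : UniqueMDiffOn (𝓡 n) e.target := e.open_target.uniqueMDiffOn
  -- The coordinate field is the tangent map of the inverse chart applied to a constant field.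
  have h := (contMDiffOn_symm_of_mem_maximalAtlas he).contMDiffOn_tangentMapWithin
    (m := ∞) (by norm_num) hs
  have hc : ContMDiffOn (𝓡 n) (𝓡 n).tangent ∞
      (fun q => (⟨q, stdVec i⟩ : TangentBundle (𝓡 n) (Coord n))) e.target := by
    intro q _
    rw [Bundle.contMDiffWithinAt_totalSpace]
    refine ⟨contMDiffWithinAt_id, ?_⟩
    simpa using contMDiffWithinAt_const
  refine (h.comp hc fun q hq => hq).congr fun q hq => ?_
  simp only [Function.comp_apply, tangentMapWithin]
  rw [mfderivWithin_of_isOpen e.open_target hq]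
  rfl

theorem contDiffOn_metricMatrix
    (g : Bundle.ContMDiffRiemannianMetric (𝓡 n) ∞ (Coord n)
      (fun x : M => TangentSpace (𝓡 n) x)) {e : OpenPartialHomeomorph M (Coord n)}
    (he : e ∈ IsManifold.maximalAtlas (𝓡 n) ∞ M) (i j : Fin n) :
    ContDiffOn ℝ ∞ (fun q => metricMatrix g e q i j) e.target := by
  rw [← contMDiffOn_iff_contDiffOn]
  intro q hq
  have hi := contMDiffOn_chartVec he i q hq
  have hj := contMDiffOn_chartVec he j q hq
  have hb := contMDiffOn_symm_of_mem_maximalAtlas he q hq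
  have : ContMDiffWithinAt (𝓡 n) ((𝓡 n).prod 𝓘(ℝ)) ∞
      (fun m ↦ Bundle.TotalSpace.mk' ℝ (E := Bundle.Trivial M ℝ) (e.symm m)
        (g.inner (e.symm m) (chartVec e m i) (chartVec e m j))) e.target q := by
    apply ContMDiffWithinAt.clm_bundle_apply₂ (F₁ := Coord n) (F₂ := Coord n)
    · exact ContMDiffAt.comp_contMDiffWithinAt q g.contMDiff.contMDiffAt hb
    · exact hi
    · exact hj
  simp only [Bundle.contMDiffWithinAt_totalSpace] at this
  exact this.2

theorem metricMatrix_symm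
    (g : Bundle.ContMDiffRiemannianMetric (𝓡 n) ∞ (Coord n)
      (fun x : M => TangentSpace (𝓡 n) x)) (e : OpenPartialHomeomorph M (Coord n))
    (q : Coord n) (i j : Fin n) : metricMatrix g e q i j = metricMatrix g e q j i :=
  g.symm _ _ _

theorem metricMatrix_pos
    (g : Bundle.ContMDiffRiemannianMetric (𝓡 n) ∞ (Coord n)
      (fun x : M => TangentSpace (𝓡 n) x)) {e : OpenPartialHomeomorph M (Coord n)}
    (he : e ∈ IsManifold.maximalAtlas (𝓡 n) ∞ M) {q : Coord n} (hq : q ∈ e.target)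
    {u : Fin n → ℝ} (hu : u ≠ 0) : 0 < scalarProd (metricMatrix g e) q u u := by
  have he1 : e ∈ IsManifold.maximalAtlas (𝓡 n) 1 M :=
    IsManifold.maximalAtlas_subset_of_le (by norm_num) he
  have hM : e.MDifferentiable (𝓡 n) (𝓡 n) :=
    ⟨fun z hz => (mdifferentiableAt_of_mem_maximalAtlas he1 hz).mdifferentiableWithinAt,
      fun z hz => (mdifferentiableAt_symm_of_mem_maximalAtlas he1 hz).mdifferentiableWithinAt⟩
  let D : Coord n →L[ℝ] TangentSpace (𝓡 n) (e.symm q) := mfderiv (𝓡 n) (𝓡 n) e.symm q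
  have hD : Function.Injective D := by
    intro a b hab
    have hc := fun v => congrArg (fun A => A v) (hM.comp_symm_deriv hq)
    exact (hc a).symm.trans ((congrArg (mfderiv (𝓡 n) (𝓡 n) e (e.symm q)) hab).trans (hc b))
  have hv : D (WithLp.toLp 2 u) = ∑ i, u i • chartVec e q i := by
    have : (WithLp.toLp 2 u : Coord n) = ∑ i, u i • stdVec i := by
      ext k
      simp [stdVec, Pi.single_apply]
    rw [this, map_sum]
    simp only [map_smul]
    rfl
  have hne : D (WithLp.toLp 2 u) ≠ 0 := by
    intro h0
    apply hu
    have := hD (h0.trans (map_zero D).symm)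
    simpa using this
  have hp := g.pos (e.symm q) _ hne
  rw [hv] at hp
  convert! hp using 1
  simp only [scalarProd, metricMatrix, Matrix.of_apply, map_sum, map_smul,
    sum_apply, smul_apply, smul_eq_mul, Finset.mul_sum]
  rw [Finset.sum_comm]
  refine Finset.sum_congr rfl fun i _ => Finset.sum_congr rfl fun j _ => ?_
  ring

end Charts

/-! ### Partial derivatives in coordinates. -/

section Calculus

variable {n : ℕ} {U : Set (Coord n)}

theorem contDiffOn_pderiv (hU : IsOpen U) {f : Coord n → ℝ} (hf : ContDiffOn ℝ ∞ f U)
    (i : Fin n) : ContDiffOn ℝ ∞ (pderiv i f) U :=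
  (hf.fderiv_of_isOpen hU (by norm_num)).clm_apply contDiffOn_const

theorem pderiv_comm (hU : IsOpen U) {f : Coord n → ℝ} (hf : ContDiffOn ℝ ∞ f U)
    {q : Coord n} (hq : q ∈ U) (i j : Fin n) :
    pderiv i (pderiv j f) q = pderiv j (pderiv i f) q := by
  have hfa : ContDiffAt ℝ ∞ f q := hf.contDiffAt (hU.mem_nhds hq)
  have hd : DifferentiableAt ℝ (fderiv ℝ f) q :=
    (hfa.fderiv_right (m := 1) (by norm_cast)).differentiableAt one_ne_zero
  have h : ∀ k l, pderiv k (pderiv l f) q = fderiv ℝ (fderiv ℝ f) q (stdVec k) (stdVec l) := by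
    intro k l
    have := (hd.hasFDerivAt.clm_apply (hasFDerivAt_const (stdVec l : Coord n) q)).fderiv
    unfold pderiv
    rw [this]
    simp
  rw [h, h]
  exact (hfa.isSymmSndFDerivAt (by simpa using WithTop.coe_le_coe.2 (le_top : (2 : ℕ∞) ≤ ⊤))).eq _ _

theorem pderiv_congr (hU : IsOpen U) {f f' : Coord n → ℝ} (h : Set.EqOn f f' U) {q : Coord n}
    (hq : q ∈ U) (i : Fin n) : pderiv i f q = pderiv i f' q := by
  unfold pderiv
  rw [(h.eventuallyEq_of_mem (hU.mem_nhds hq)).fderiv_eq]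

theorem pderiv_add {f f' : Coord n → ℝ} {q : Coord n} (hf : DifferentiableAt ℝ f q)
    (hf' : DifferentiableAt ℝ f' q) (i : Fin n) :
    pderiv i (fun x => f x + f' x) q = pderiv i f q + pderiv i f' q := by
  unfold pderiv
  rw [fderiv_fun_add hf hf']
  rfl

theorem pderiv_mul {f f' : Coord n → ℝ} {q : Coord n} (hf : DifferentiableAt ℝ f q)
    (hf' : DifferentiableAt ℝ f' q) (i : Fin n) :
    pderiv i (fun x => f x * f' x) q = pderiv i f q * f' q + f q * pderiv i f' q := by
  unfold pderiv
  rw [fderiv_fun_mul hf hf']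
  simp
  ring

theorem pderiv_sum {ι : Type*} (s : Finset ι) {f : ι → Coord n → ℝ} {q : Coord n}
    (hf : ∀ k ∈ s, DifferentiableAt ℝ (f k) q) (i : Fin n) :
    pderiv i (fun x => ∑ k ∈ s, f k x) q = ∑ k ∈ s, pderiv i (f k) q := by
  unfold pderiv
  rw [fderiv_fun_sum hf]
  simp

end Calculus

/-! ### Christoffel symbols and the symmetries of the curvature. -/

/-- `g` is, on the open set `U`, the matrix of components of a smooth Riemannian metric. -/
structure IsMetricOn {n : ℕ} (U : Set (Coord n)) (g : Coord n → Matrix (Fin n) (Fin n) ℝ) :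
    Prop where
  isOpen : IsOpen U
  smooth : ∀ i j, ContDiffOn ℝ ∞ (fun q => g q i j) U
  symm : ∀ q i j, g q i j = g q j i
  pos : ∀ q ∈ U, ∀ u : Fin n → ℝ, u ≠ 0 → 0 < scalarProd g q u u

theorem scalarProd_eq_dotProduct {n : ℕ} (g : Coord n → Matrix (Fin n) (Fin n) ℝ) (q : Coord n)
    (u v : Fin n → ℝ) : scalarProd g q u v = u ⬝ᵥ (g q *ᵥ v) := by
  simp only [scalarProd, dotProduct, Matrix.mulVec, Finset.mul_sum]
  exact Finset.sum_congr rfl fun i _ => Finset.sum_congr rfl fun j _ => by ring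

namespace IsMetricOn

variable {n : ℕ} {U : Set (Coord n)} {g : Coord n → Matrix (Fin n) (Fin n) ℝ}
  {q : Coord n}

theorem transpose_eq (hg : IsMetricOn U g) (q : Coord n) : (g q)ᵀ = g q := by
  ext i j
  exact hg.symm q j i

theorem isUnit (hg : IsMetricOn U g) (hq : q ∈ U) : IsUnit (g q) := by
  rw [← Matrix.mulVec_injective_iff_isUnit]
  intro u v huv
  by_contra hne
  have hp := hg.pos q hq (u - v) (sub_ne_zero.2 hne)
  rw [scalarProd_eq_dotProduct, Matrix.mulVec_sub, huv, sub_self, dotProduct_zero] at hp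
  exact lt_irrefl _ hp

theorem isUnit_det (hg : IsMetricOn U g) (hq : q ∈ U) : IsUnit (g q).det :=
  (Matrix.isUnit_iff_isUnit_det _).1 (hg.isUnit hq)

theorem mul_inv (hg : IsMetricOn U g) (hq : q ∈ U) : g q * (g q)⁻¹ = 1 :=
  Matrix.mul_nonsing_inv _ (hg.isUnit_det hq)

theorem inv_transpose (hg : IsMetricOn U g) (q : Coord n) : ((g q)⁻¹)ᵀ = (g q)⁻¹ := by
  rw [Matrix.transpose_nonsing_inv, hg.transpose_eq]

/-- Cramer's rule: the adjugate and the determinant are polynomials in the entries, and the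
determinant does not vanish on `U`. -/
theorem contDiffOn_inv (hg : IsMetricOn U g) (i j : Fin n) :
    ContDiffOn ℝ ∞ (fun q => (g q)⁻¹ i j) U := by
  have hdet : ∀ A : Coord n → Matrix (Fin n) (Fin n) ℝ,
      (∀ i j, ContDiffOn ℝ ∞ (fun q => A q i j) U) → ContDiffOn ℝ ∞ (fun q => (A q).det) U := by
    intro A hA
    simp only [Matrix.det_apply']
    exact ContDiffOn.sum fun σ _ => contDiffOn_const.mul (contDiffOn_prod fun k _ => hA _ _)
  have hadj : ContDiffOn ℝ ∞ (fun q => (g q).adjugate i j) U := by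
    simp only [Matrix.adjugate_apply]
    refine hdet _ fun k l => ?_
    simp only [Matrix.updateRow_apply]
    split_ifs
    · exact contDiffOn_const
    · exact hg.smooth k l
  refine (((hdet g hg.smooth).inv fun q hq => (hg.isUnit_det hq).ne_zero).mul hadj).congr
    fun q _ => ?_
  simp [Matrix.inv_def]

theorem contDiffOn_christoffel (hg : IsMetricOn U g) (k i h : Fin n) :
    ContDiffOn ℝ ∞ (christoffel g k i h) U := by
  unfold christoffel
  have hp : ∀ i j k, ContDiffOn ℝ ∞ (pderiv i (fun x => g x j k)) U := fun i j k =>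
    contDiffOn_pderiv hg.isOpen (hg.smooth j k) i
  exact contDiffOn_const.mul (ContDiffOn.sum fun l _ =>
    (hg.contDiffOn_inv k l).mul (((hp i l h).add (hp h i l)).sub (hp l i h)))

theorem differentiableAt (hg : IsMetricOn U g) (hq : q ∈ U) {f : Coord n → ℝ}
    (hf : ContDiffOn ℝ ∞ f U) : DifferentiableAt ℝ f q :=
  (hf.contDiffAt (hg.isOpen.mem_nhds hq)).differentiableAt (by norm_num)

theorem christoffel_symm (hg : IsMetricOn U g) (q : Coord n) (k i h : Fin n) :
    christoffel g k i h q = christoffel g k h i q := by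
  unfold christoffel
  -- Symmetry is available off `U` too, so these are equal functions and may be exchanged under a
  -- partial derivative.
  have h' : ∀ a b, (fun x => g x a b) = fun x => g x b a := fun a b => funext fun x => hg.symm x a b
  congr 1
  refine Finset.sum_congr rfl fun l _ => ?_
  rw [h' l h, h' i l, h' i h]
  ring

theorem sum_mul_christoffel (hg : IsMetricOn U g) (hq : q ∈ U) (k i h : Fin n) :
    ∑ m, g q k m * christoffel g m i h q = (1 / 2) *
      (pderiv i (fun x => g x k h) q + pderiv h (fun x => g x i k) q
        - pderiv k (fun x => g x i h) q) := by
  set S : Fin n → ℝ := fun l => pderiv i (fun x => g x l h) q + pderiv h (fun x => g x i l) q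
    - pderiv l (fun x => g x i h) q with hS
  have h1 : (fun m => christoffel g m i h q) = (1 / 2 : ℝ) • ((g q)⁻¹ *ᵥ S) := by
    ext m
    simp [christoffel, Matrix.mulVec, dotProduct, hS]
  have h2 : g q *ᵥ (fun m => christoffel g m i h q) = (1 / 2 : ℝ) • S := by
    rw [h1, Matrix.mulVec_smul, Matrix.mulVec_mulVec, hg.mul_inv hq, Matrix.one_mulVec]
  exact congrFun h2 k

/-- Metric compatibility `∇g = 0`: in the sum of the two lowered Christoffel symbols all derivatives
cancel except `∂_j g_hk`. -/
theorem pderiv_metric (hg : IsMetricOn U g) (hq : q ∈ U) (j h k : Fin n) :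
    pderiv j (fun x => g x h k) q =
      ∑ m, (christoffel g m j h q * g q m k + g q h m * christoffel g m j k q) := by
  have h' : ∀ a b, (fun x => g x a b) = fun x => g x b a := fun a b => funext fun x => hg.symm x a b
  rw [Finset.sum_add_distrib, hg.sum_mul_christoffel hq]
  have : ∑ m, christoffel g m j h q * g q m k = ∑ m, g q k m * christoffel g m j h q :=
    Finset.sum_congr rfl fun m _ => by rw [hg.symm q k m, mul_comm]
  rw [this, hg.sum_mul_christoffel hq, h' k h, h' j h, h' j k]
  ring

end IsMetricOn

/-- The matrix `(Γ^k_{ih})` of the connection, for fixed `i`. -/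
def christoffelMatrix {n : ℕ} (g : Coord n → Matrix (Fin n) (Fin n) ℝ) (i : Fin n)
    (q : Coord n) : Matrix (Fin n) (Fin n) ℝ :=
  Matrix.of fun k h => christoffel g k i h q

/-- The matrix `(∂_j Γ^k_{ih})`, for fixed `i` and `j`. -/
def pderivChristoffel {n : ℕ} (g : Coord n → Matrix (Fin n) (Fin n) ℝ) (j i : Fin n)
    (q : Coord n) : Matrix (Fin n) (Fin n) ℝ :=
  Matrix.of fun k h => pderiv j (christoffel g k i h) q

/-- The matrix `(R^h_{kij})` of the curvature operator, for fixed `i` and `j`. -/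
def curvatureMatrix {n : ℕ} (g : Coord n → Matrix (Fin n) (Fin n) ℝ) (i j : Fin n)
    (q : Coord n) : Matrix (Fin n) (Fin n) ℝ :=
  Matrix.of fun h k => curvature g h k i j q

theorem curvatureMatrix_eq {n : ℕ} (g : Coord n → Matrix (Fin n) (Fin n) ℝ) (i j : Fin n)
    (q : Coord n) : curvatureMatrix g i j q =
      pderivChristoffel g i j q - pderivChristoffel g j i q
        + (christoffelMatrix g i q * christoffelMatrix g j q
          - christoffelMatrix g j q * christoffelMatrix g i q) := by
  ext h k
  simp [curvatureMatrix, curvature, pderivChristoffel, christoffelMatrix, Matrix.mul_apply,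
    Finset.sum_sub_distrib]

namespace IsMetricOn

variable {n : ℕ} {U : Set (Coord n)} {g : Coord n → Matrix (Fin n) (Fin n) ℝ}
  {q : Coord n}

/-- Differentiate `∂_j g = Γ_jᵀ g + g Γ_j` and substitute the same formula for `∂_i g`. -/
theorem pderiv_pderiv_metric (hg : IsMetricOn U g) (hq : q ∈ U) (i j : Fin n) :
    (Matrix.of fun h k => pderiv i (pderiv j (fun x => g x h k)) q) =
      (pderivChristoffel g i j q)ᵀ * g q
      + (christoffelMatrix g j q)ᵀ *
          ((christoffelMatrix g i q)ᵀ * g q + g q * christoffelMatrix g i q)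
      + ((christoffelMatrix g i q)ᵀ * g q + g q * christoffelMatrix g i q) *
          christoffelMatrix g j q
      + g q * pderivChristoffel g i j q := by
  have hdg : ∀ h k, pderiv i (fun x => g x h k) q =
      ((christoffelMatrix g i q)ᵀ * g q + g q * christoffelMatrix g i q) h k := by
    intro h k
    rw [hg.pderiv_metric hq, Finset.sum_add_distrib]
    simp [christoffelMatrix, Matrix.mul_apply]
  ext h k
  have dg := fun a b => hg.differentiableAt hq (hg.smooth a b)
  have dΓ := fun a b c => hg.differentiableAt hq (hg.contDiffOn_christoffel a b c)
  have hd : ∀ m ∈ Finset.univ, DifferentiableAt ℝ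
      (fun x => christoffel g m j h x * g x m k + g x h m * christoffel g m j k x) q :=
    fun m _ => ((dΓ m j h).mul (dg m k)).add ((dg h m).mul (dΓ m j k))
  rw [Matrix.of_apply, pderiv_congr hg.isOpen (fun x hx => hg.pderiv_metric hx j h k) hq,
    pderiv_sum _ hd]
  have : ∀ m, pderiv i (fun x => christoffel g m j h x * g x m k + g x h m * christoffel g m j k x) q
      = pderiv i (christoffel g m j h) q * g q m k
        + christoffel g m j h q *
          ((christoffelMatrix g i q)ᵀ * g q + g q * christoffelMatrix g i q) m k
        + ((christoffelMatrix g i q)ᵀ * g q + g q * christoffelMatrix g i q) h m *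
          christoffel g m j k q
        + g q h m * pderiv i (christoffel g m j k) q := by
    intro m
    have d₁ : DifferentiableAt ℝ (fun x => christoffel g m j h x * g x m k) q :=
      (dΓ m j h).mul (dg m k)
    have d₂ : DifferentiableAt ℝ (fun x => g x h m * christoffel g m j k x) q :=
      (dg h m).mul (dΓ m j k)
    rw [pderiv_add d₁ d₂, pderiv_mul (dΓ m j h) (dg m k), pderiv_mul (dg h m) (dΓ m j k), hdg, hdg]
    ring
  simp only [this, Finset.sum_add_distrib]
  rw [Matrix.add_apply, Matrix.add_apply, Matrix.add_apply]
  simp only [Matrix.mul_apply (N := g q), Matrix.mul_apply (M := g q),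
    Matrix.mul_apply (M := (christoffelMatrix g j q)ᵀ), Matrix.mul_apply (N := christoffelMatrix g j q)]
  rfl

/-- Second partial derivatives of `g` commute. Antisymmetrizing their expression in `i, j` cancels
the terms `Γ_jᵀ g Γ_i + Γ_iᵀ g Γ_j` and leaves exactly the left-hand side. -/
theorem curvatureMatrix_skew (hg : IsMetricOn U g) (hq : q ∈ U) (i j : Fin n) :
    (curvatureMatrix g i j q)ᵀ * g q + g q * curvatureMatrix g i j q = 0 := by
  have hc : (Matrix.of fun h k => pderiv i (pderiv j (fun x => g x h k)) q) =
      Matrix.of fun h k => pderiv j (pderiv i (fun x => g x h k)) q := by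
    ext h k
    exact pderiv_comm hg.isOpen (hg.smooth h k) hq i j
  rw [hg.pderiv_pderiv_metric hq, hg.pderiv_pderiv_metric hq] at hc
  rw [curvatureMatrix_eq]
  simp only [Matrix.transpose_add, Matrix.transpose_sub, Matrix.transpose_mul]
  rw [← sub_eq_zero] at hc
  rw [← hc]
  noncomm_ring

theorem curvature_swap (g : Coord n → Matrix (Fin n) (Fin n) ℝ) (h k i j : Fin n) (q : Coord n) :
    curvature g h k i j q = -curvature g h k j i q := by
  simp only [curvature, Finset.sum_sub_distrib]
  ring

theorem curvature_bianchi (hg : IsMetricOn U g) (h k i j : Fin n) (q : Coord n) :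
    curvature g h k i j q + curvature g h i j k q + curvature g h j k i q = 0 := by
  have hs : ∀ a b c, christoffel g a b c = christoffel g a c b := fun a b c =>
    funext fun x => hg.christoffel_symm x a b c
  simp only [curvature, Finset.sum_sub_distrib]
  rw [hs h i k, hs h k j, hs h i j]
  simp only [hs _ k j, hs _ j i, hs _ k i]
  ring

end IsMetricOn

/-! ### Constant sectional curvature determines the curvature tensor. -/

/-- A tensor with the symmetries of a curvature tensor vanishes as soon as its sectional
curvatures do. -/
theorem curvatureLike_eq_zero {V : Type*} [AddCommGroup V] {T : V → V → V → V → ℝ}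
    (add₁ : ∀ a b v w z, T (a + b) v w z = T a v w z + T b v w z)
    (swap₁₂ : ∀ u v w z, T u v w z = -T v u w z)
    (add₃ : ∀ u v a b z, T u v (a + b) z = T u v a z + T u v b z)
    (swap₃₄ : ∀ u v w z, T u v w z = -T u v z w)
    (bianchi : ∀ u v w z, T u v w z + T v w u z + T w u v z = 0)
    (hT : ∀ u v, T u v v u = 0) (u v w z : V) : T u v w z = 0 := by
  have add₂ : ∀ u a b w z, T u (a + b) w z = T u a w z + T u b w z := by
    intro u a b w z
    rw [swap₁₂, add₁, swap₁₂ u a, swap₁₂ u b]; ring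
  have add₄ : ∀ u v w a b, T u v w (a + b) = T u v w a + T u v w b := by
    intro u v w a b
    rw [swap₃₄, add₃, swap₃₄ u v w a, swap₃₄ u v w b]; ring
  -- The usual consequence of four Bianchi identities and the two skew symmetries.
  have pair : ∀ u v w z, T u v w z = T w z u v := by
    intro u v w z
    linarith [bianchi u v w z, bianchi v w z u, bianchi w z u v, bianchi z u v w,
      swap₁₂ u v w z, swap₁₂ v w u z, swap₁₂ w u v z, swap₃₄ u v w z, swap₃₄ v w u z,
      swap₃₄ w u v z, swap₁₂ w z u v, swap₁₂ z u v w, swap₁₂ v w z u, swap₁₂ u z v w,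
      swap₃₄ w z u v, swap₃₄ z u v w, swap₃₄ u w z v, swap₃₄ z v w u, swap₁₂ z v w u,
      swap₁₂ u w z v, swap₁₂ w u z v, swap₁₂ v z w u, swap₃₄ v z w u, swap₃₄ w u z v]
  -- Polarization of `hT` in the middle slots; `h2` polarizes once more, in the outer ones.
  have h1 : ∀ u v w, T u v w u = 0 := by
    intro u v w
    have h := hT u (v + w)
    rw [add₂, add₃, add₃, hT, hT] at h
    linarith [pair u v w u, swap₁₂ w u u v, swap₃₄ u w u v]
  have h2 : ∀ u v w z, T u v w z = -T z v w u := by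
    intro u v w z
    have h := h1 (u + z) v w
    rw [add₁, add₄, add₄, h1, h1] at h
    linarith
  have h3 : ∀ u v w z, T u v w z = -T u w v z := by
    intro u v w z
    rw [h2, pair z v w u, swap₁₂, swap₃₄]; ring
  -- Skew in slots 1, 2 and in slots 2, 3, `T` is invariant under cyclic permutation of the first
  -- three, so Bianchi reads `3 T = 0`.
  linarith [bianchi u v w z, h3 u v w z, swap₁₂ v w u z, h3 w v u z, h3 v w u z, swap₁₂ w u v z]

section Tensor

variable {n : ℕ} (g : Coord n → Matrix (Fin n) (Fin n) ℝ) (q : Coord n)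

theorem scalarProd_add_left (u u' v : Fin n → ℝ) :
    scalarProd g q (u + u') v = scalarProd g q u v + scalarProd g q u' v := by
  simp only [scalarProd_eq_dotProduct, add_dotProduct]

theorem scalarProd_add_right (u v v' : Fin n → ℝ) :
    scalarProd g q u (v + v') = scalarProd g q u v + scalarProd g q u v' := by
  simp only [scalarProd_eq_dotProduct, Matrix.mulVec_add, dotProduct_add]

theorem scalarProd_smul_left (a : ℝ) (u v : Fin n → ℝ) :
    scalarProd g q (a • u) v = a * scalarProd g q u v := by
  simp only [scalarProd_eq_dotProduct, smul_dotProduct, smul_eq_mul]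

theorem scalarProd_smul_right (a : ℝ) (u v : Fin n → ℝ) :
    scalarProd g q u (a • v) = a * scalarProd g q u v := by
  simp only [scalarProd_eq_dotProduct, Matrix.mulVec_smul, dotProduct_smul, smul_eq_mul]

/-- Exposes the matrices `R_ij`, so that linearity and `curvatureMatrix_skew` apply termwise. -/
theorem curvatureVec_eq_sum (u v w : Fin n → ℝ) :
    curvatureVec g q u v w = ∑ i, ∑ j, (u i * v j) • (curvatureMatrix g i j q *ᵥ w) := by
  ext h
  simp only [curvatureVec, Finset.sum_apply, Pi.smul_apply, Matrix.mulVec, dotProduct,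
    smul_eq_mul, Finset.mul_sum, curvatureMatrix, Matrix.of_apply]
  rw [Finset.sum_comm]
  refine Finset.sum_congr rfl fun i _ => ?_
  rw [Finset.sum_comm]
  exact Finset.sum_congr rfl fun j _ => Finset.sum_congr rfl fun k _ => by ring

theorem curvatureVec_add_left (u u' v w : Fin n → ℝ) :
    curvatureVec g q (u + u') v w = curvatureVec g q u v w + curvatureVec g q u' v w := by
  simp only [curvatureVec_eq_sum, Pi.add_apply, add_mul, add_smul, Finset.sum_add_distrib]

theorem curvatureVec_add_right (u v w w' : Fin n → ℝ) :
    curvatureVec g q u v (w + w') = curvatureVec g q u v w + curvatureVec g q u v w' := by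
  simp only [curvatureVec_eq_sum, Matrix.mulVec_add, smul_add, Finset.sum_add_distrib]

theorem curvatureVec_smul_middle (a : ℝ) (u v w : Fin n → ℝ) :
    curvatureVec g q u (a • v) w = a • curvatureVec g q u v w := by
  simp only [curvatureVec_eq_sum, Finset.smul_sum, smul_smul, Pi.smul_apply, smul_eq_mul]
  refine Finset.sum_congr rfl fun i _ => Finset.sum_congr rfl fun j _ => ?_
  congr 1
  ring

theorem curvatureVec_swap (u v w : Fin n → ℝ) :
    curvatureVec g q u v w = -curvatureVec g q v u w := by
  rw [curvatureVec_eq_sum, curvatureVec_eq_sum, Finset.sum_comm, ← Finset.sum_neg_distrib]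
  refine Finset.sum_congr rfl fun i _ => ?_
  rw [← Finset.sum_neg_distrib]
  refine Finset.sum_congr rfl fun j _ => ?_
  have : curvatureMatrix g j i q = -curvatureMatrix g i j q := by
    ext h k
    exact IsMetricOn.curvature_swap g h k j i q
  rw [this, Matrix.neg_mulVec, smul_neg, mul_comm]

variable {g q} {U : Set (Coord n)}

theorem IsMetricOn.scalarProd_comm (hg : IsMetricOn U g) (u v : Fin n → ℝ) :
    scalarProd g q u v = scalarProd g q v u := by
  rw [scalarProd_eq_dotProduct, scalarProd_eq_dotProduct, dotProduct_comm,
    Matrix.dotProduct_mulVec, ← Matrix.mulVec_transpose, hg.transpose_eq]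

theorem IsMetricOn.curvatureVec_bianchi (hg : IsMetricOn U g) (u v w : Fin n → ℝ) :
    curvatureVec g q u v w + curvatureVec g q v w u + curvatureVec g q w u v = 0 := by
  ext h
  have e1 : curvatureVec g q u v w h =
      ∑ i, ∑ j, ∑ k, curvature g h k i j q * (u i * v j * w k) := by
    simp only [curvatureVec]
    rw [Finset.sum_comm]
    refine Finset.sum_congr rfl fun i _ => ?_
    rw [Finset.sum_comm]
    exact Finset.sum_congr rfl fun j _ => Finset.sum_congr rfl fun k _ => by ring
  have e2 : curvatureVec g q v w u h =
      ∑ i, ∑ j, ∑ k, curvature g h i j k q * (u i * v j * w k) := by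
    simp only [curvatureVec]
    exact Finset.sum_congr rfl fun i _ => Finset.sum_congr rfl fun j _ =>
      Finset.sum_congr rfl fun k _ => by ring
  have e3 : curvatureVec g q w u v h =
      ∑ i, ∑ j, ∑ k, curvature g h j k i q * (u i * v j * w k) := by
    simp only [curvatureVec]
    symm
    rw [Finset.sum_comm]
    refine Finset.sum_congr rfl fun j _ => ?_
    rw [Finset.sum_comm]
    exact Finset.sum_congr rfl fun j _ => Finset.sum_congr rfl fun k _ => by ring
  rw [Pi.add_apply, Pi.add_apply, e1, e2, e3]
  simp only [← Finset.sum_add_distrib, ← add_mul, hg.curvature_bianchi, zero_mul,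
    Finset.sum_const_zero, Pi.zero_apply]

theorem IsMetricOn.scalarProd_curvatureVec_swap (hg : IsMetricOn U g) (hq : q ∈ U)
    (u v w z : Fin n → ℝ) :
    scalarProd g q (curvatureVec g q u v w) z = -scalarProd g q (curvatureVec g q u v z) w := by
  rw [hg.scalarProd_comm, hg.scalarProd_comm _ w]
  simp only [scalarProd_eq_dotProduct, curvatureVec_eq_sum, Matrix.mulVec_sum, dotProduct_sum,
    Matrix.mulVec_smul, dotProduct_smul, ← Finset.sum_neg_distrib, ← smul_neg]
  refine Finset.sum_congr rfl fun i _ => Finset.sum_congr rfl fun j _ => ?_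
  congr 1
  rw [Matrix.mulVec_mulVec, Matrix.mulVec_mulVec, dotProduct_comm, ← Matrix.vecMul_transpose,
    ← Matrix.dotProduct_mulVec, ← dotProduct_neg, ← Matrix.neg_mulVec]
  congr 2
  rw [Matrix.transpose_mul, hg.transpose_eq]
  exact eq_neg_of_add_eq_zero_left (hg.curvatureMatrix_skew hq i j)

/-- The curvature tensor of a metric of constant sectional curvature. -/
theorem IsMetricOn.scalarProd_curvatureVec (hg : IsMetricOn U g) (hq : q ∈ U) {c : ℝ}
    (hc : c ≠ 0) (hsec : ∀ u v : Fin n → ℝ, LinearIndependent ℝ ![u, v] →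
      sectionalCurvature g q u v = c) (u v w z : Fin n → ℝ) :
    scalarProd g q (curvatureVec g q u v w) z =
      c * (scalarProd g q v w * scalarProd g q u z - scalarProd g q u w * scalarProd g q v z) := by
  rw [← sub_eq_zero]
  refine curvatureLike_eq_zero (T := fun u v w z => scalarProd g q (curvatureVec g q u v w) z -
    c * (scalarProd g q v w * scalarProd g q u z - scalarProd g q u w * scalarProd g q v z))
    ?_ ?_ ?_ ?_ ?_ ?_ u v w z
  · intro a b v w z
    simp only [curvatureVec_add_left, scalarProd_add_left]
    ring
  · intro u v w z
    have : scalarProd g q (curvatureVec g q u v w) z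
        = -scalarProd g q (curvatureVec g q v u w) z := by
      rw [curvatureVec_swap, ← neg_one_smul ℝ, scalarProd_smul_left]
      ring
    simp only [this]
    ring
  · intro u v a b z
    simp only [curvatureVec_add_right, scalarProd_add_left, scalarProd_add_right]
    ring
  · intro u v w z
    simp only [hg.scalarProd_curvatureVec_swap hq u v w z]
    ring
  · intro u v w z
    have : scalarProd g q (curvatureVec g q u v w) z + scalarProd g q (curvatureVec g q v w u) z
        + scalarProd g q (curvatureVec g q w u v) z = 0 := by
      rw [← scalarProd_add_left, ← scalarProd_add_left, hg.curvatureVec_bianchi,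
        scalarProd_eq_dotProduct, zero_dotProduct]
    simp only [hg.scalarProd_comm v u, hg.scalarProd_comm w u, hg.scalarProd_comm w v]
    linear_combination this
  · intro u v
    by_cases hli : LinearIndependent ℝ ![u, v]
    · have h := hsec u v hli
      -- If the Gram determinant were zero, the quotient would take the default value `0`, against
      -- `c ≠ 0`.
      have hD : scalarProd g q u u * scalarProd g q v v - scalarProd g q u v ^ 2 ≠ 0 := by
        intro h0
        rw [sectionalCurvature, h0, div_zero] at h
        exact hc h.symm
      rw [sectionalCurvature, div_eq_iff hD] at h
      simp only [h, hg.scalarProd_comm v u]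
      ring
    -- For dependent vectors nothing is known from `hsec`, but both sides vanish identically.
    · have hzero : ∀ w z, scalarProd g q (curvatureVec g q u u w) z = 0 := by
        intro w z
        have h0 : curvatureVec g q u u w = 0 := self_eq_neg.1 (curvatureVec_swap g q u u w)
        rw [h0, scalarProd_eq_dotProduct, zero_dotProduct]
      by_cases hu : u = 0
      · subst hu
        have : ∀ v, scalarProd g q v 0 = 0 := fun v => by
          rw [scalarProd_eq_dotProduct, Matrix.mulVec_zero, dotProduct_zero]
        simp [this]
      · rw [LinearIndependent.pair_iff' hu] at hli
        push Not at hli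
        obtain ⟨a, rfl⟩ := hli
        simp only [curvatureVec_smul_middle, scalarProd_smul_left, scalarProd_smul_right, hzero]
        ring

/-- Contraction with the covector `p` is the scalar product with `r = g⁻¹ p`; the formula for `R` is
then evaluated on basis vectors. -/
theorem IsMetricOn.sum_mul_curvature (hg : IsMetricOn U g) (hq : q ∈ U) {c : ℝ}
    (hc : c ≠ 0) (hsec : ∀ u v : Fin n → ℝ, LinearIndependent ℝ ![u, v] →
      sectionalCurvature g q u v = c) (p : Fin n → ℝ) (k i j : Fin n) :
    ∑ h, p h * curvature g h k i j q = c * (p i * g q j k - p j * g q i k) := by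
  set r : Fin n → ℝ := (g q)⁻¹ *ᵥ p with hr
  have hgr : g q *ᵥ r = p := by rw [hr, Matrix.mulVec_mulVec, hg.mul_inv hq, Matrix.one_mulVec]
  have h := hg.scalarProd_curvatureVec hq hc hsec (Pi.single i 1) (Pi.single j 1)
    (Pi.single k 1) r
  have hv : curvatureVec g q (Pi.single i 1) (Pi.single j 1) (Pi.single k 1)
      = fun h => curvature g h k i j q := by
    ext h
    simp [curvatureVec, Pi.single_apply]
  simp only [scalarProd_eq_dotProduct, hgr, hv] at h
  simp only [single_one_dotProduct, Matrix.mulVec_single_one, Matrix.col_apply] at h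
  simp only [dotProduct] at h
  rw [Finset.sum_congr rfl fun h _ => mul_comm _ _, h]
  ring

end Tensor

/-! ### The Nijenhuis tensor and its reduction to a frame. -/

section Nijenhuis

variable {E : Type*} [NormedAddCommGroup E] [NormedSpace ℝ E] {J : E → E →L[ℝ] E} {y : E}

/-- The Nijenhuis tensor of `J` at `y` in terms of the derivative of `J`. -/
def nijenhuisTensor (J : E → E →L[ℝ] E) (y u v : E) : E :=
  fderiv ℝ J y (J y u) v - fderiv ℝ J y (J y v) u + J y (fderiv ℝ J y v u)
    - J y (fderiv ℝ J y u v)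

/-- All derivatives of `X` and `Y` cancel, those of `[X, Y]` by `J² = -1`; hence only the values at
`y` count. -/
theorem nijenhuis_eq_nijenhuisTensor {X Y : E → E} (hJ : DifferentiableAt ℝ J y)
    (hX : DifferentiableAt ℝ X y) (hY : DifferentiableAt ℝ Y y)
    (hsq : ∀ u, J y (J y u) = -u) :
    nijenhuis J X Y y = nijenhuisTensor J y (X y) (Y y) := by
  have h : ∀ Z : E → E, DifferentiableAt ℝ Z y → ∀ w,
      fderiv ℝ (fun z => J z (Z z)) y w = fderiv ℝ J y w (Z y) + J y (fderiv ℝ Z y w) := by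
    intro Z hZ w
    rw [fderiv_clm_apply hJ hZ]
    simp [add_comm]
  simp only [nijenhuis, nijenhuisTensor, VectorField.lieBracket, h X hX, h Y hY, map_sub, map_add,
    hsq]
  abel

theorem nijenhuisTensor_swap (u v : E) : nijenhuisTensor J y u v = -nijenhuisTensor J y v u := by
  simp only [nijenhuisTensor]
  abel

theorem nijenhuisTensor_add (u u' v : E) :
    nijenhuisTensor J y (u + u') v = nijenhuisTensor J y u v + nijenhuisTensor J y u' v := by
  simp only [nijenhuisTensor, map_add, add_apply]
  abel

theorem nijenhuisTensor_smul (a : ℝ) (u v : E) :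
    nijenhuisTensor J y (a • u) v = a • nijenhuisTensor J y u v := by
  simp only [nijenhuisTensor, map_smul, smul_apply, smul_sub, smul_add]

/-- Differentiating `J² = -1`, which therefore has to hold near `y`, shows that every directional
derivative of `J` anticommutes with `J`. -/
theorem nijenhuisTensor_map (hJ : DifferentiableAt ℝ J y)
    (hsq : ∀ᶠ z in 𝓝 y, ∀ u, J z (J z u) = -u) (u v : E) :
    nijenhuisTensor J y (J y u) v = -J y (nijenhuisTensor J y u v) := by
  have hsy := hsq.self_of_nhds
  have hd : ∀ w x, fderiv ℝ J y w (J y x) = -J y (fderiv ℝ J y w x) := by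
    intro w x
    have h1 : (fun z => J z (J z x)) =ᶠ[𝓝 y] fun _ => -x := hsq.mono fun z hz => hz x
    have hx : DifferentiableAt ℝ (fun z => J z x) y := hJ.clm_apply (differentiableAt_const x)
    have h2 := congrArg (fun L : E →L[ℝ] E => L w) h1.fderiv_eq
    rw [fderiv_clm_apply hJ hx, fderiv_clm_apply hJ (differentiableAt_const x)] at h2
    simp at h2
    rw [eq_neg_iff_add_eq_zero, add_comm]
    exact h2
  simp only [nijenhuisTensor, map_sub, map_add, hd, hsy, map_neg, neg_apply]
  abel

/-- An almost complex structure is integrable at `y` if its Nijenhuis tensor vanishes on vector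
fields which, together with their images, span the tangent space. -/
theorem nijenhuis_eq_zero_of_frame {ι : Type*} {H : ι → E → E} (hJ : DifferentiableAt ℝ J y)
    (hsq : ∀ᶠ z in 𝓝 y, ∀ u, J z (J z u) = -u) (hH : ∀ i, DifferentiableAt ℝ (H i) y)
    (hspan : Submodule.span ℝ (Set.range (fun i => H i y) ∪ Set.range fun i => J y (H i y)) = ⊤)
    (hN : ∀ i j, nijenhuis J (H i) (H j) y = 0) {X Y : E → E} (hX : DifferentiableAt ℝ X y)
    (hY : DifferentiableAt ℝ Y y) : nijenhuis J X Y y = 0 := by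
  have hsy := hsq.self_of_nhds
  have h0 : ∀ v, nijenhuisTensor J y 0 v = 0 := fun v => by simp [nijenhuisTensor]
  -- Applied twice, once for each slot, with skew symmetry in between.
  have key : ∀ v, (∀ i, nijenhuisTensor J y (H i y) v = 0) → ∀ u, nijenhuisTensor J y u v = 0 := by
    intro v hv u
    have hu : u ∈ Submodule.span ℝ
        (Set.range (fun i => H i y) ∪ Set.range fun i => J y (H i y)) := hspan ▸ trivial
    induction hu using Submodule.span_induction with
    | mem x hx =>
      rcases hx with ⟨i, rfl⟩ | ⟨i, rfl⟩
      · exact hv i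
      · simp only
        rw [nijenhuisTensor_map hJ hsq, hv i, map_zero, neg_zero]
    | zero => exact h0 v
    | add a b _ _ ha hb => rw [nijenhuisTensor_add, ha, hb, add_zero]
    | smul a x _ hx => rw [nijenhuisTensor_smul, hx, smul_zero]
  rw [nijenhuis_eq_nijenhuisTensor hJ hX hY hsy]
  refine key _ (fun i => ?_) _
  rw [nijenhuisTensor_swap, key _ (fun j => ?_), neg_zero]
  rw [← nijenhuis_eq_nijenhuisTensor hJ (hH j) (hH i) hsy, hN]

end Nijenhuis

/-! ### Directional derivatives along the adapted frame. -/

section DirectionalDerivative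

variable {E : Type*} [NormedAddCommGroup E] [NormedSpace ℝ E] {y : E}

theorem fderiv_mul_eq {f f' : E → ℝ} (hf : DifferentiableAt ℝ f y)
    (hf' : DifferentiableAt ℝ f' y) (X : E) :
    fderiv ℝ (fun z => f z * f' z) y X = fderiv ℝ f y X * f' y + f y * fderiv ℝ f' y X := by
  rw [fderiv_fun_mul hf hf']
  simp
  ring

theorem fderiv_add_eq {f f' : E → ℝ} (hf : DifferentiableAt ℝ f y)
    (hf' : DifferentiableAt ℝ f' y) (X : E) :
    fderiv ℝ (fun z => f z + f' z) y X = fderiv ℝ f y X + fderiv ℝ f' y X := by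
  rw [fderiv_fun_add hf hf']
  rfl

theorem fderiv_sum_eq {ι : Type*} (s : Finset ι) {f : ι → E → ℝ}
    (hf : ∀ k, DifferentiableAt ℝ (f k) y) (X : E) :
    fderiv ℝ (fun z => ∑ k ∈ s, f k z) y X = ∑ k ∈ s, fderiv ℝ (f k) y X := by
  rw [fderiv_fun_sum fun k _ => hf k]
  simp

theorem fderiv_scalar_comp_eq {f : E → ℝ} {s : ℝ → ℝ} (hs : DifferentiableAt ℝ s (f y))
    (hf : DifferentiableAt ℝ f y) (X : E) :
    fderiv ℝ (fun z => s (f z)) y X = deriv s (f y) * fderiv ℝ f y X := by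
  have := (hs.hasDerivAt.comp_hasFDerivAt y hf.hasFDerivAt).fderiv
  simp only [Function.comp_def] at this
  rw [this]
  simp

end DirectionalDerivative

/-- The part of the coordinate space of the cotangent bundle over `U` with `p ≠ 0`. -/
def phaseSet {n : ℕ} (U : Set (Coord n)) : Set (PhaseCoord n) := {y | y.1 ∈ U ∧ y.2 ≠ 0}

theorem isOpen_phaseSet {n : ℕ} {U : Set (Coord n)} (hU : IsOpen U) : IsOpen (phaseSet U) :=
  (hU.preimage continuous_fst).inter (isOpen_ne.preimage continuous_snd)

section Frame

variable {n : ℕ} (g : Coord n → Matrix (Fin n) (Fin n) ℝ) (y : PhaseCoord n)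

theorem sum_smul_vert (a : Fin n → ℝ) : ∑ h, a h • (vert h : PhaseCoord n) = (0, WithLp.toLp 2 a) := by
  refine Prod.ext ?_ ?_
  · simp [vert, Prod.fst_sum]
  · ext k
    simp [vert, Prod.snd_sum, stdVec, Pi.single_apply]

@[simp] theorem horiz_fst (i : Fin n) : (horiz g y i).1 = stdVec i := by
  simp [horiz, sum_smul_vert]

@[simp] theorem horiz_snd (i h : Fin n) : (horiz g y i).2 h = christoffelZero g y i h := by
  simp [horiz, sum_smul_vert]

@[simp] theorem vert_fst (i : Fin n) : (vert i : PhaseCoord n).1 = 0 := rfl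

@[simp] theorem vert_snd (i : Fin n) : (vert i : PhaseCoord n).2 = stdVec i := rfl

@[simp] theorem stdVec_apply (i k : Fin n) : (stdVec i : Coord n) k = if i = k then 1 else 0 := by
  simp [stdVec, eq_comm]

@[simp] theorem dq_apply (i : Fin n) (X : PhaseCoord n) : dq i X = X.1 i := rfl

theorem Dp_apply (i : Fin n) (X : PhaseCoord n) :
    Dp g y i X = X.2 i - ∑ j, christoffelZero g y i j * X.1 j := by
  simp [Dp, dp]

@[simp] theorem Dp_vert (i j : Fin n) : Dp g y i (vert j) = if j = i then 1 else 0 := by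
  simp [Dp_apply]

end Frame

namespace IsMetricOn

variable {n : ℕ} {U : Set (Coord n)} {g : Coord n → Matrix (Fin n) (Fin n) ℝ}
  {y : PhaseCoord n}

theorem christoffelZero_symm (hg : IsMetricOn U g) (y : PhaseCoord n) (i j : Fin n) :
    christoffelZero g y i j = christoffelZero g y j i := by
  simp only [christoffelZero, hg.christoffel_symm y.1 _ i j]

theorem Dp_horiz (hg : IsMetricOn U g) (y : PhaseCoord n) (i j : Fin n) :
    Dp g y i (horiz g y j) = 0 := by
  simp [Dp_apply, hg.christoffelZero_symm y i j]

theorem contDiffOn_comp_fst {f : Coord n → ℝ} (hf : ContDiffOn ℝ ∞ f U) :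
    ContDiffOn ℝ ∞ (fun y : PhaseCoord n => f y.1) (phaseSet U) :=
  hf.comp contDiffOn_fst fun _ hy => hy.1

theorem contDiffOn_momentum (i : Fin n) :
    ContDiffOn ℝ ∞ (fun y : PhaseCoord n => y.2 i) (phaseSet U) := by
  fun_prop

theorem contDiffOn_raised (hg : IsMetricOn U g) (i : Fin n) :
    ContDiffOn ℝ ∞ (fun y => raised g y i) (phaseSet U) :=
  ContDiffOn.sum fun h _ => (contDiffOn_momentum h).mul (contDiffOn_comp_fst (hg.contDiffOn_inv h i))

theorem contDiffOn_christoffelZero (hg : IsMetricOn U g) (i j : Fin n) :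
    ContDiffOn ℝ ∞ (fun y => christoffelZero g y i j) (phaseSet U) :=
  ContDiffOn.sum fun k _ =>
    (contDiffOn_momentum k).mul (contDiffOn_comp_fst (hg.contDiffOn_christoffel k i j))

theorem energy_eq (g : Coord n → Matrix (Fin n) (Fin n) ℝ) (y : PhaseCoord n) :
    energy g y = (1 / 2) * ∑ k, raised g y k * y.2 k := by
  simp only [energy, raised, Finset.sum_mul]
  rw [Finset.sum_comm]
  congr 1
  exact Finset.sum_congr rfl fun i _ => Finset.sum_congr rfl fun k _ => by ring

theorem contDiffOn_energy (hg : IsMetricOn U g) : ContDiffOn ℝ ∞ (energy g) (phaseSet U) := by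
  rw [show energy g = fun y => (1 / 2) * ∑ k, raised g y k * y.2 k from funext (energy_eq g)]
  exact contDiffOn_const.mul
    (ContDiffOn.sum fun k _ => (hg.contDiffOn_raised k).mul (contDiffOn_momentum k))

theorem raised_eq_vecMul (g : Coord n → Matrix (Fin n) (Fin n) ℝ) (y : PhaseCoord n) :
    raised g y = (y.2 : Fin n → ℝ) ᵥ* (g y.1)⁻¹ := rfl

theorem raised_eq_mulVec (hg : IsMetricOn U g) (y : PhaseCoord n) :
    raised g y = (g y.1)⁻¹ *ᵥ (y.2 : Fin n → ℝ) := by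
  rw [raised_eq_vecMul, ← Matrix.mulVec_transpose, hg.inv_transpose]

theorem mulVec_raised (hg : IsMetricOn U g) (hy : y ∈ phaseSet U) :
    g y.1 *ᵥ raised g y = (y.2 : Fin n → ℝ) := by
  rw [hg.raised_eq_mulVec, Matrix.mulVec_mulVec, hg.mul_inv hy.1, Matrix.one_mulVec]

theorem raised_vecMul (hg : IsMetricOn U g) (hy : y ∈ phaseSet U) :
    raised g y ᵥ* g y.1 = (y.2 : Fin n → ℝ) := by
  rw [← Matrix.mulVec_transpose, hg.transpose_eq, hg.mulVec_raised hy]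

theorem raised_dotProduct (g : Coord n → Matrix (Fin n) (Fin n) ℝ) (y : PhaseCoord n) :
    raised g y ⬝ᵥ (y.2 : Fin n → ℝ) = 2 * energy g y := by
  rw [energy_eq]
  simp [dotProduct]

theorem energy_pos (hg : IsMetricOn U g) (hy : y ∈ phaseSet U) : 0 < energy g y := by
  have hr : raised g y ≠ 0 := by
    intro h0
    apply hy.2
    have h := hg.mulVec_raised hy
    rw [h0, Matrix.mulVec_zero] at h
    ext i
    exact (congrFun h i).symm
  have := hg.pos y.1 hy.1 _ hr
  rw [scalarProd_eq_dotProduct, hg.mulVec_raised hy, raised_dotProduct] at this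
  linarith

theorem differentiableAt_phase (hg : IsMetricOn U g) (hy : y ∈ phaseSet U)
    {F : Type*} [NormedAddCommGroup F] [NormedSpace ℝ F] {f : PhaseCoord n → F}
    (hf : ContDiffOn ℝ ∞ f (phaseSet U)) : DifferentiableAt ℝ f y :=
  (hf.contDiffAt ((isOpen_phaseSet hg.isOpen).mem_nhds hy)).differentiableAt (by norm_num)

theorem fderiv_momentum (y : PhaseCoord n) (i : Fin n) (X : PhaseCoord n) :
    fderiv ℝ (fun z : PhaseCoord n => z.2 i) y X = X.2 i := by
  have : HasFDerivAt (fun z : PhaseCoord n => z.2 i) (dp i) y := (dp i).hasFDerivAt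
  rw [this.fderiv]
  rfl

theorem fderiv_comp_fst (hg : IsMetricOn U g) (hy : y ∈ phaseSet U) {f : Coord n → ℝ}
    (hf : ContDiffOn ℝ ∞ f U) (X : PhaseCoord n) :
    fderiv ℝ (fun z : PhaseCoord n => f z.1) y X = fderiv ℝ f y.1 X.1 := by
  have := ((hg.differentiableAt hy.1 hf).hasFDerivAt.comp y (hasFDerivAt_fst (p := y))).fderiv
  simp only [Function.comp_def] at this
  rw [this]
  rfl

theorem fderiv_christoffelZero (hg : IsMetricOn U g) (hy : y ∈ phaseSet U) (i l : Fin n)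
    (X : PhaseCoord n) :
    fderiv ℝ (fun z => christoffelZero g z i l) y X =
      ∑ k, (X.2 k * christoffel g k i l y.1 + y.2 k * fderiv ℝ (christoffel g k i l) y.1 X.1) := by
  unfold christoffelZero
  have d₁ := fun k => hg.differentiableAt_phase hy (contDiffOn_momentum (U := U) k)
  have d₂ := fun k => hg.differentiableAt_phase hy
    (contDiffOn_comp_fst (hg.contDiffOn_christoffel k i l))
  rw [fderiv_sum_eq _ fun k => (d₁ k).fun_mul (d₂ k)]
  refine Finset.sum_congr rfl fun k _ => ?_
  rw [fderiv_mul_eq (d₁ k) (d₂ k), fderiv_momentum,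
    hg.fderiv_comp_fst hy (hg.contDiffOn_christoffel k i l)]

theorem fderiv_christoffelZero_vert (hg : IsMetricOn U g) (hy : y ∈ phaseSet U) (i l k : Fin n) :
    fderiv ℝ (fun z => christoffelZero g z i l) y (vert k) = christoffel g k i l y.1 := by
  rw [hg.fderiv_christoffelZero hy]
  simp

/-- The bracket of two horizontal frame fields, for constant sectional curvature. -/
theorem fderiv_christoffelZero_horiz_sub (hg : IsMetricOn U g) (hy : y ∈ phaseSet U) {c : ℝ}
    (hc : c ≠ 0) (hsec : ∀ u v : Fin n → ℝ, LinearIndependent ℝ ![u, v] →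
      sectionalCurvature g y.1 u v = c) (i j l : Fin n) :
    fderiv ℝ (fun z => christoffelZero g z j l) y (horiz g y i)
      - fderiv ℝ (fun z => christoffelZero g z i l) y (horiz g y j)
      = c * (y.2 i * g y.1 j l - y.2 j * g y.1 i l) := by
  rw [← hg.sum_mul_curvature hy.1 hc hsec (fun k => y.2 k) l i j,
    hg.fderiv_christoffelZero hy, hg.fderiv_christoffelZero hy]
  simp only [horiz_fst, horiz_snd, curvature, mul_add, mul_sub, Finset.sum_add_distrib,
    Finset.sum_sub_distrib, Finset.mul_sum]
  -- The quadratic terms of the curvature come from the vertical part `Γ^0_{ik}` of the horizontal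
  -- field, as `∂Γ^0_{jl}/∂p_k = Γ^k_{jl}`.
  have h : ∀ i j, ∑ k, christoffelZero g y i k * christoffel g k j l y.1 =
      ∑ h, ∑ m, y.2 h * (christoffel g h i m y.1 * christoffel g m j l y.1) := by
    intro i j
    rw [Finset.sum_comm]
    simp only [christoffelZero, Finset.sum_mul, mul_assoc]
  rw [h, h]
  simp only [pderiv]
  ring

theorem mulVec_raised_apply (hg : IsMetricOn U g) (hy : y ∈ phaseSet U) (i : Fin n) :
    ∑ l, g y.1 i l * raised g y l = y.2 i :=
  congrFun (hg.mulVec_raised hy) i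

/-- The derivative of `p_i = g_il g^{0l}`, contracted with `g^{0i}`. -/
theorem sum_fderiv_raised_mul (hg : IsMetricOn U g) (hy : y ∈ phaseSet U) (X : PhaseCoord n) :
    ∑ l, fderiv ℝ (fun z => raised g z l) y X * y.2 l =
      ∑ i, raised g y i * X.2 i
        - ∑ i, ∑ l, raised g y i * fderiv ℝ (fun x => g x i l) y.1 X.1 * raised g y l := by
  have d₁ := fun i l => hg.differentiableAt_phase hy (contDiffOn_comp_fst (hg.smooth i l))
  have d₂ := fun l => hg.differentiableAt_phase hy (hg.contDiffOn_raised l)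
  have h : ∀ i, X.2 i = ∑ l, (fderiv ℝ (fun x => g x i l) y.1 X.1 * raised g y l
      + g y.1 i l * fderiv ℝ (fun z => raised g z l) y X) := by
    intro i
    -- Differentiating `p = g r` near `y` avoids the derivative of `g⁻¹`.
    have he : (fun z : PhaseCoord n => z.2 i) =ᶠ[𝓝 y]
        fun z => ∑ l, g z.1 i l * raised g z l :=
      ((isOpen_phaseSet hg.isOpen).eventually_mem hy).mono
        fun z hz => (hg.mulVec_raised_apply hz i).symm
    rw [← fderiv_momentum y i X, he.fderiv_eq, fderiv_sum_eq _ fun l => (d₁ i l).fun_mul (d₂ l)]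
    refine Finset.sum_congr rfl fun l _ => ?_
    rw [fderiv_mul_eq (d₁ i l) (d₂ l), hg.fderiv_comp_fst hy (hg.smooth i l)]
  have h2 : ∑ i, raised g y i * X.2 i =
      ∑ i, ∑ l, raised g y i * fderiv ℝ (fun x => g x i l) y.1 X.1 * raised g y l
      + ∑ i, ∑ l, raised g y i * g y.1 i l * fderiv ℝ (fun z => raised g z l) y X := by
    rw [← Finset.sum_add_distrib]
    refine Finset.sum_congr rfl fun i _ => ?_
    rw [h i, Finset.mul_sum, ← Finset.sum_add_distrib]
    exact Finset.sum_congr rfl fun l _ => by ring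
  have h3 : ∑ i, ∑ l, raised g y i * g y.1 i l * fderiv ℝ (fun z => raised g z l) y X
      = ∑ l, fderiv ℝ (fun z => raised g z l) y X * y.2 l := by
    rw [Finset.sum_comm]
    refine Finset.sum_congr rfl fun l _ => ?_
    rw [← Finset.sum_mul, mul_comm]
    congr 1
    exact congrFun (hg.raised_vecMul hy) l
  linarith

theorem fderiv_energy (hg : IsMetricOn U g) (hy : y ∈ phaseSet U) (X : PhaseCoord n) :
    fderiv ℝ (energy g) y X = ∑ i, raised g y i * X.2 i
      - (1 / 2) * ∑ i, ∑ l, raised g y i * fderiv ℝ (fun x => g x i l) y.1 X.1 * raised g y l := by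
  have d₁ := fun i => hg.differentiableAt_phase hy (contDiffOn_momentum (U := U) i)
  have d₂ := fun l => hg.differentiableAt_phase hy (hg.contDiffOn_raised l)
  rw [show energy g = fun y => (1 / 2) * ∑ k, raised g y k * y.2 k from funext (energy_eq g)]
  rw [fderiv_mul_eq (differentiableAt_const _)
    (DifferentiableAt.fun_sum fun k _ => (d₂ k).fun_mul (d₁ k)),
    fderiv_sum_eq _ fun k => (d₂ k).fun_mul (d₁ k)]
  have : ∀ k, fderiv ℝ (fun z => raised g z k * z.2 k) y X =
      fderiv ℝ (fun z => raised g z k) y X * y.2 k + raised g y k * X.2 k := fun k => by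
    rw [fderiv_mul_eq (d₂ k) (d₁ k), fderiv_momentum]
  simp only [this, Finset.sum_add_distrib, hg.sum_fderiv_raised_mul hy]
  simp
  ring

theorem fderiv_energy_vert (hg : IsMetricOn U g) (hy : y ∈ phaseSet U) (k : Fin n) :
    fderiv ℝ (energy g) y (vert k) = raised g y k := by
  rw [hg.fderiv_energy hy]
  simp

/-- Parallel transport preserves length: by `∇g = 0`, each of the two terms of `∂_j g` contributes
`g^{0i} Γ^0_{ji}`, and half their sum cancels the change of `p`. -/
theorem fderiv_energy_horiz (hg : IsMetricOn U g) (hy : y ∈ phaseSet U) (j : Fin n) :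
    fderiv ℝ (energy g) y (horiz g y j) = 0 := by
  rw [hg.fderiv_energy hy]
  simp only [horiz_fst, horiz_snd]
  have h : ∀ i l, fderiv ℝ (fun x => g x i l) y.1 (stdVec j) = _ :=
    fun i l => hg.pderiv_metric hy.1 j i l
  have e : ∀ i, ∑ l, ∑ m, raised g y l * (g y.1 l m * christoffel g m j i y.1) =
      christoffelZero g y j i := by
    intro i
    rw [Finset.sum_comm]
    simp only [christoffelZero]
    refine Finset.sum_congr rfl fun m _ => ?_
    rw [← congrFun (hg.raised_vecMul hy) m]
    simp only [Matrix.vecMul, dotProduct, Finset.sum_mul, mul_assoc]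
  have e₁ : ∑ i, ∑ l, ∑ m, raised g y i * (g y.1 i m * christoffel g m j l y.1) * raised g y l
      = ∑ i, raised g y i * christoffelZero g y j i := by
    rw [Finset.sum_comm]
    refine Finset.sum_congr rfl fun i _ => ?_
    rw [← e i, mul_comm]
    simp only [Finset.sum_mul]
  have e₂ : ∑ i, ∑ l, ∑ m, raised g y i * (christoffel g m j i y.1 * g y.1 m l) * raised g y l
      = ∑ i, raised g y i * christoffelZero g y j i := by
    refine Finset.sum_congr rfl fun i _ => ?_
    rw [← e i]
    simp only [Finset.mul_sum]
    refine Finset.sum_congr rfl fun l _ => Finset.sum_congr rfl fun m _ => ?_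
    rw [hg.symm y.1 m l]
    ring
  have e₃ : ∑ i, ∑ l, raised g y i * (∑ m, (christoffel g m j i y.1 * g y.1 m l
      + g y.1 i m * christoffel g m j l y.1)) * raised g y l
      = 2 * ∑ i, raised g y i * christoffelZero g y j i := by
    simp only [mul_add, add_mul, Finset.sum_add_distrib, Finset.mul_sum, Finset.sum_mul] at e₁ e₂ ⊢
    rw [e₁, e₂, ← Finset.sum_add_distrib]
    exact Finset.sum_congr rfl fun i _ => by ring
  simp only [h]
  rw [e₃]
  ring

end IsMetricOn

/-! ### Matrix algebra of `J` and `G` in the adapted frame. -/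

/-- The conditions on the coefficient functions `b₁`, `λ`, `μ`. -/
structure AdmissibleCoefficients (c : ℝ) (b₁ lam mu : ℝ → ℝ) : Prop where
  c_pos : 0 < c
  smooth_b₁ : ContDiffOn ℝ ∞ b₁ (Set.Ioi 0)
  smooth_lam : ContDiffOn ℝ ∞ lam (Set.Ioi 0)
  smooth_mu : ContDiffOn ℝ ∞ mu (Set.Ioi 0)
  b₁_gt : ∀ t, 0 < t → -√(c / (2 * t)) < b₁ t
  lam_pos : ∀ t, 0 < t → 0 < lam t
  lam_mu_pos : ∀ t, 0 < t → 0 < lam t + 2 * t * mu t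

section Matrices

variable {n : ℕ} (c : ℝ) (b₁ lam mu : ℝ → ℝ) (g : Coord n → Matrix (Fin n) (Fin n) ℝ)
  (y : PhaseCoord n)

/-- The matrix `(J^{(1)}_{ij})`. -/
def J1Matrix : Matrix (Fin n) (Fin n) ℝ := Matrix.of (J1 c b₁ g y)

/-- The matrix `(J_{(2)}^{ij})`. -/
def J2Matrix : Matrix (Fin n) (Fin n) ℝ := Matrix.of (J2 c b₁ g y)

/-- The matrix `(G^{(1)}_{ij})`. -/
def G1Matrix : Matrix (Fin n) (Fin n) ℝ := Matrix.of (G1 c b₁ lam mu g y)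

/-- The matrix `(G_{(2)}^{ij})`. -/
def G2Matrix : Matrix (Fin n) (Fin n) ℝ := Matrix.of (G2 c b₁ lam mu g y)

/-- The matrix `(λ δ^i_j + μ g^{0i} p_j)` of the fundamental form. -/
def formMatrix : Matrix (Fin n) (Fin n) ℝ :=
  lam (energy g y) • 1 + mu (energy g y) • Matrix.vecMulVec (raised g y) y.2

theorem J1Matrix_eq : J1Matrix c b₁ g y = √(2 * c * energy g y) • g y.1
    + b₁ (energy g y) • Matrix.vecMulVec (y.2 : Fin n → ℝ) (y.2 : Fin n → ℝ) := by
  ext i j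
  simp [J1Matrix, J1, Matrix.vecMulVec_apply, mul_assoc]

theorem J2Matrix_eq : J2Matrix c b₁ g y = (1 / √(2 * c * energy g y)) • (g y.1)⁻¹
    - (b₁ (energy g y) /
      (2 * √c * energy g y * (√c + √(2 * energy g y) * b₁ (energy g y)))) •
        Matrix.vecMulVec (raised g y) (raised g y) := by
  ext i j
  simp [J2Matrix, J2, Matrix.vecMulVec_apply, mul_assoc]

theorem G1Matrix_eq : G1Matrix c b₁ lam mu g y = coefC1 c lam (energy g y) • g y.1
    + coefD1 c b₁ lam mu (energy g y) •
      Matrix.vecMulVec (y.2 : Fin n → ℝ) (y.2 : Fin n → ℝ) := by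
  ext i j
  simp [G1Matrix, G1, Matrix.vecMulVec_apply, mul_assoc]

theorem G2Matrix_eq : G2Matrix c b₁ lam mu g y = coefC2 c lam (energy g y) • (g y.1)⁻¹
    + coefD2 c b₁ lam mu (energy g y) • Matrix.vecMulVec (raised g y) (raised g y) := by
  ext i j
  simp [G2Matrix, G2, Matrix.vecMulVec_apply, mul_assoc]

end Matrices

namespace AdmissibleCoefficients

variable {c : ℝ} {b₁ lam mu : ℝ → ℝ} {t : ℝ}

/-- This is the lower bound on `b₁` multiplied by `√(2t)`; it keeps the rank-one perturbations
invertible. -/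
theorem denominator_pos (h : AdmissibleCoefficients c b₁ lam mu) (ht : 0 < t) :
    0 < √c + √(2 * t) * b₁ t := by
  have h1 := h.b₁_gt t ht
  have hw : 0 < √(2 * t) := Real.sqrt_pos.2 (by positivity)
  rw [Real.sqrt_div h.c_pos.le] at h1
  have h2 := mul_lt_mul_of_pos_left h1 hw
  have h3 : √(2 * t) * -(√c / √(2 * t)) = -√c := by field_simp
  linarith

theorem sqrt_eq (h : AdmissibleCoefficients c b₁ lam mu) (t : ℝ) :
    √(2 * c * t) = √c * √(2 * t) := by
  rw [← Real.sqrt_mul h.c_pos.le]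
  congr 1
  ring

theorem sqrt_pos (h : AdmissibleCoefficients c b₁ lam mu) (ht : 0 < t) : 0 < √(2 * c * t) :=
  Real.sqrt_pos.2 (by have := h.c_pos; positivity)

theorem hasDerivAt_sqrt (h : AdmissibleCoefficients c b₁ lam mu) (ht : 0 < t) :
    HasDerivAt (fun x => √(2 * c * x)) (c / √(2 * c * t)) t := by
  have hc := h.c_pos
  have h1 : HasDerivAt (fun x => 2 * c * x) (2 * c) t := by
    simpa using (hasDerivAt_id t).const_mul (2 * c)
  convert! h1.sqrt (by positivity) using 1
  have := h.sqrt_pos ht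
  field_simp

theorem contDiffOn_sqrt (h : AdmissibleCoefficients c b₁ lam mu) :
    ContDiffOn ℝ ∞ (fun x => √(2 * c * x)) (Set.Ioi 0) := by
  refine ContDiffOn.sqrt (contDiffOn_const.mul contDiffOn_id) fun x hx => ?_
  have := h.c_pos
  have : 0 < x := hx
  change 2 * c * x ≠ 0
  positivity

end AdmissibleCoefficients

section Algebra

variable {n : ℕ} {c : ℝ} {b₁ lam mu : ℝ → ℝ} {U : Set (Coord n)}
  {g : Coord n → Matrix (Fin n) (Fin n) ℝ} {y : PhaseCoord n}

/-- The Sherman–Morrison formula for the inverse of `s g + b p pᵀ` with `s = √(2ct)`. Here `p · g⁻¹p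
= 2t`, and `s (s + 2tb) = 2 √c t (√c + √(2t) b)`. -/
theorem J1Matrix_mul_J2Matrix (h : AdmissibleCoefficients c b₁ lam mu) (hg : IsMetricOn U g)
    (hy : y ∈ phaseSet U) : J1Matrix c b₁ g y * J2Matrix c b₁ g y = 1 := by
  have ht := hg.energy_pos hy
  have hA := h.denominator_pos ht
  have ha : 0 < √c := Real.sqrt_pos.2 h.c_pos
  have hw : 0 < √(2 * energy g y) := Real.sqrt_pos.2 (by positivity)
  have hpr : (y.2 : Fin n → ℝ) ⬝ᵥ raised g y = 2 * energy g y := by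
    rw [dotProduct_comm, IsMetricOn.raised_dotProduct]
  have hw2 : √(2 * energy g y) ^ 2 = 2 * energy g y := Real.sq_sqrt (by positivity)
  have hgr : ∀ v : Fin n → ℝ, g y.1 * Matrix.vecMulVec (raised g y) v = Matrix.vecMulVec y.2 v :=
    fun v => by rw [Matrix.mul_vecMulVec, hg.mulVec_raised hy]
  have hpg : ∀ v : Fin n → ℝ, Matrix.vecMulVec v y.2 * (g y.1)⁻¹ = Matrix.vecMulVec v (raised g y) :=
    fun v => by rw [Matrix.vecMulVec_mul, ← IsMetricOn.raised_eq_vecMul]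
  rw [J1Matrix_eq, J2Matrix_eq]
  simp only [add_mul, mul_sub, Matrix.smul_mul, Matrix.mul_smul, hg.mul_inv hy.1,
    hgr, hpg, Matrix.vecMulVec_mul_vecMulVec, hpr, h.sqrt_eq, smul_smul, Matrix.vecMulVec_smul]
  set a := √c
  set w := √(2 * energy g y)
  set b := b₁ (energy g y)
  have e : 2 * a * energy g y = a * w ^ 2 := by rw [hw2]; ring
  rw [e, ← hw2]
  ext i j
  simp only [Matrix.add_apply, Matrix.sub_apply, Matrix.smul_apply, smul_eq_mul]
  field_simp
  ring

/-- The coefficients of `G` are chosen so that this factorization and `G2Matrix_eq_mul` hold;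
compatibility and `φ` then involve only `J₁ J₂ = 1`. -/
theorem G1Matrix_eq_mul (h : AdmissibleCoefficients c b₁ lam mu) (hg : IsMetricOn U g)
    (hy : y ∈ phaseSet U) :
    G1Matrix c b₁ lam mu g y = J1Matrix c b₁ g y * formMatrix lam mu g y := by
  have ht := hg.energy_pos hy
  have hpr : (y.2 : Fin n → ℝ) ⬝ᵥ raised g y = 2 * energy g y := by
    rw [dotProduct_comm, IsMetricOn.raised_dotProduct]
  have hw2 : √(2 * energy g y) ^ 2 = 2 * energy g y := Real.sq_sqrt (by positivity)
  have hgr : ∀ v : Fin n → ℝ, g y.1 * Matrix.vecMulVec (raised g y) v = Matrix.vecMulVec y.2 v :=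
    fun v => by rw [Matrix.mul_vecMulVec, hg.mulVec_raised hy]
  rw [J1Matrix_eq, G1Matrix_eq, formMatrix]
  simp only [add_mul, mul_add, Matrix.smul_mul, Matrix.mul_smul, mul_one,
    Matrix.vecMulVec_mul_vecMulVec, hgr, hpr, smul_smul, Matrix.vecMulVec_smul, coefC1, coefD1,
    h.sqrt_eq]
  generalize √(2 * energy g y) = w at hw2 ⊢
  rw [← hw2]
  ext i j
  simp only [Matrix.add_apply, Matrix.smul_apply, smul_eq_mul]
  ring

theorem G2Matrix_eq_mul (h : AdmissibleCoefficients c b₁ lam mu) (hg : IsMetricOn U g)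
    (hy : y ∈ phaseSet U) :
    G2Matrix c b₁ lam mu g y = formMatrix lam mu g y * J2Matrix c b₁ g y := by
  have ht := hg.energy_pos hy
  have hA := h.denominator_pos ht
  have ha : 0 < √c := Real.sqrt_pos.2 h.c_pos
  have hw : 0 < √(2 * energy g y) := Real.sqrt_pos.2 (by positivity)
  have hpr : (y.2 : Fin n → ℝ) ⬝ᵥ raised g y = 2 * energy g y := by
    rw [dotProduct_comm, IsMetricOn.raised_dotProduct]
  have hw2 : √(2 * energy g y) ^ 2 = 2 * energy g y := Real.sq_sqrt (by positivity)
  have hpg : ∀ v : Fin n → ℝ, Matrix.vecMulVec v y.2 * (g y.1)⁻¹ = Matrix.vecMulVec v (raised g y) :=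
    fun v => by rw [Matrix.vecMulVec_mul, ← IsMetricOn.raised_eq_vecMul]
  rw [J2Matrix_eq, G2Matrix_eq, formMatrix]
  simp only [add_mul, mul_sub, Matrix.smul_mul, Matrix.mul_smul, one_mul,
    Matrix.vecMulVec_mul_vecMulVec, hpg, hpr, h.sqrt_eq, smul_smul, Matrix.vecMulVec_smul,
    coefC2, coefD2]
  set a := √c
  set w := √(2 * energy g y)
  set b := b₁ (energy g y)
  have e : 2 * a * energy g y = a * w ^ 2 := by rw [hw2]; ring
  rw [e, ← hw2]
  ext i j
  simp only [Matrix.add_apply, Matrix.sub_apply, Matrix.smul_apply, smul_eq_mul]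
  field_simp
  ring

theorem J2Matrix_mul_J1Matrix (h : AdmissibleCoefficients c b₁ lam mu) (hg : IsMetricOn U g)
    (hy : y ∈ phaseSet U) : J2Matrix c b₁ g y * J1Matrix c b₁ g y = 1 :=
  mul_eq_one_comm.1 (J1Matrix_mul_J2Matrix h hg hy)

theorem J1Matrix_transpose (hg : IsMetricOn U g) :
    (J1Matrix c b₁ g y)ᵀ = J1Matrix c b₁ g y := by
  rw [J1Matrix_eq, Matrix.transpose_add, Matrix.transpose_smul, Matrix.transpose_smul,
    hg.transpose_eq, Matrix.transpose_vecMulVec]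

theorem J2Matrix_transpose (hg : IsMetricOn U g) :
    (J2Matrix c b₁ g y)ᵀ = J2Matrix c b₁ g y := by
  rw [J2Matrix_eq, Matrix.transpose_sub, Matrix.transpose_smul, Matrix.transpose_smul,
    hg.inv_transpose, Matrix.transpose_vecMulVec]

theorem G1Matrix_transpose (hg : IsMetricOn U g) :
    (G1Matrix c b₁ lam mu g y)ᵀ = G1Matrix c b₁ lam mu g y := by
  rw [G1Matrix_eq, Matrix.transpose_add, Matrix.transpose_smul, Matrix.transpose_smul,
    hg.transpose_eq, Matrix.transpose_vecMulVec]

theorem G2Matrix_transpose (hg : IsMetricOn U g) :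
    (G2Matrix c b₁ lam mu g y)ᵀ = G2Matrix c b₁ lam mu g y := by
  rw [G2Matrix_eq, Matrix.transpose_add, Matrix.transpose_smul, Matrix.transpose_smul,
    hg.inv_transpose, Matrix.transpose_vecMulVec]

end Algebra

section Components

variable {n : ℕ} (g : Coord n → Matrix (Fin n) (Fin n) ℝ) (y : PhaseCoord n)

/-- The horizontal components of a tangent vector. -/
def horizPart (X : PhaseCoord n) : Fin n → ℝ := fun i => dq i X

/-- The vertical components of a tangent vector. -/
def vertPart (X : PhaseCoord n) : Fin n → ℝ := fun i => Dp g y i X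

variable {g y}

theorem eq_of_components {X Y : PhaseCoord n} (h₁ : horizPart X = horizPart Y)
    (h₂ : vertPart g y X = vertPart g y Y) : X = Y := by
  have h₁' : X.1 = Y.1 := by
    ext i
    exact congrFun h₁ i
  refine Prod.ext h₁' ?_
  ext i
  have := congrFun h₂ i
  simp only [vertPart, Dp_apply, h₁'] at this
  linarith

theorem horizPart_neg (X : PhaseCoord n) : horizPart (-X) = -horizPart X := by
  ext i
  simp [horizPart]

theorem vertPart_neg (X : PhaseCoord n) : vertPart g y (-X) = -vertPart g y X := by
  ext i
  simp [vertPart]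

variable {c : ℝ} {b₁ lam mu : ℝ → ℝ} {U : Set (Coord n)}

theorem J_apply (X : PhaseCoord n) : J c b₁ g y X =
    ∑ j, (∑ i, J1 c b₁ g y i j * dq i X) • vert j
      - ∑ j, (∑ i, J2 c b₁ g y i j * Dp g y i X) • horiz g y j := by
  have e₁ : J c b₁ g y X = (∑ i, ∑ j, (J1 c b₁ g y i j * dq i X) • vert j)
      - ∑ i, ∑ j, (J2 c b₁ g y i j * Dp g y i X) • horiz g y j := by
    simp [J, smul_smul]
  rw [e₁, Finset.sum_comm]
  simp only [Finset.sum_smul]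
  congr 1
  rw [Finset.sum_comm]

/-- With `vertPart_J` this gives the off-diagonal blocks of `J`. The definition contracts the first
index, hence the use of symmetry of the blocks. -/
theorem horizPart_J (hg : IsMetricOn U g) (X : PhaseCoord n) :
    horizPart (J c b₁ g y X) = -(J2Matrix c b₁ g y *ᵥ vertPart g y X) := by
  rw [← J2Matrix_transpose hg]
  ext k
  simp [horizPart, J_apply, Prod.fst_sum, Matrix.mulVec, dotProduct, vertPart, J2Matrix]

theorem vertPart_J (hg : IsMetricOn U g) (X : PhaseCoord n) :
    vertPart g y (J c b₁ g y X) = J1Matrix c b₁ g y *ᵥ horizPart X := by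
  rw [← J1Matrix_transpose hg]
  ext k
  simp only [vertPart, J_apply, map_sub, map_sum, map_smul, hg.Dp_horiz, Dp_vert]
  simp [Matrix.mulVec, dotProduct, horizPart, J1Matrix]

theorem G_apply (X Y : PhaseCoord n) : G c b₁ lam mu g y X Y =
    horizPart X ⬝ᵥ (G1Matrix c b₁ lam mu g y *ᵥ horizPart Y)
      + vertPart g y X ⬝ᵥ (G2Matrix c b₁ lam mu g y *ᵥ vertPart g y Y) := by
  simp only [G, dotProduct, Matrix.mulVec, Finset.mul_sum, horizPart, vertPart, G1Matrix, G2Matrix,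
    add_apply, sum_apply, smul_apply, ContinuousLinearMap.smulRight_apply, Matrix.of_apply,
    smul_eq_mul]
  congr 1 <;>
  exact Finset.sum_congr rfl fun i _ => Finset.sum_congr rfl fun j _ => by ring

theorem J_sq (h : AdmissibleCoefficients c b₁ lam mu) (hg : IsMetricOn U g)
    (hy : y ∈ phaseSet U) (X : PhaseCoord n) : J c b₁ g y (J c b₁ g y X) = -X := by
  refine eq_of_components (g := g) (y := y) ?_ ?_
  · rw [horizPart_J hg, vertPart_J hg, Matrix.mulVec_mulVec, J2Matrix_mul_J1Matrix h hg hy,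
      Matrix.one_mulVec, horizPart_neg]
  · rw [vertPart_J hg, horizPart_J hg, Matrix.mulVec_neg, Matrix.mulVec_mulVec,
      J1Matrix_mul_J2Matrix h hg hy, Matrix.one_mulVec, vertPart_neg]

theorem G_symm (hg : IsMetricOn U g) (X Y : PhaseCoord n) :
    G c b₁ lam mu g y X Y = G c b₁ lam mu g y Y X := by
  rw [G_apply, G_apply, Matrix.dotProduct_mulVec, Matrix.dotProduct_mulVec,
    ← Matrix.mulVec_transpose, ← Matrix.mulVec_transpose, G1Matrix_transpose hg,
    G2Matrix_transpose hg, dotProduct_comm, dotProduct_comm (_ *ᵥ _)]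

theorem G_J_J (h : AdmissibleCoefficients c b₁ lam mu) (hg : IsMetricOn U g)
    (hy : y ∈ phaseSet U) (X Y : PhaseCoord n) :
    G c b₁ lam mu g y (J c b₁ g y X) (J c b₁ g y Y) = G c b₁ lam mu g y X Y := by
  have e : ∀ (A : Matrix (Fin n) (Fin n) ℝ), Aᵀ = A → ∀ u v : Fin n → ℝ,
      (A *ᵥ u) ⬝ᵥ v = u ⬝ᵥ (A *ᵥ v) := by
    intro A hA u v
    rw [Matrix.dotProduct_mulVec, ← Matrix.mulVec_transpose, hA]
  have h₁ : J2Matrix c b₁ g y * G1Matrix c b₁ lam mu g y * J2Matrix c b₁ g y =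
      G2Matrix c b₁ lam mu g y := by
    rw [G1Matrix_eq_mul h hg hy, G2Matrix_eq_mul h hg hy, ← Matrix.mul_assoc,
      J2Matrix_mul_J1Matrix h hg hy, Matrix.one_mul]
  have h₂ : J1Matrix c b₁ g y * G2Matrix c b₁ lam mu g y * J1Matrix c b₁ g y =
      G1Matrix c b₁ lam mu g y := by
    rw [G1Matrix_eq_mul h hg hy, G2Matrix_eq_mul h hg hy, Matrix.mul_assoc, Matrix.mul_assoc,
      J2Matrix_mul_J1Matrix h hg hy, Matrix.mul_one]
  rw [G_apply, G_apply, horizPart_J hg, horizPart_J hg, vertPart_J hg, vertPart_J hg,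
    Matrix.mulVec_neg, neg_dotProduct_neg, e _ (J2Matrix_transpose hg),
    e _ (J1Matrix_transpose hg), Matrix.mulVec_mulVec, Matrix.mulVec_mulVec, Matrix.mulVec_mulVec,
    Matrix.mulVec_mulVec, h₁, h₂, add_comm]

/-- The two factorizations of `G` yield `G₂ J₁ = F` and, after transposition, `G₁ J₂ = Fᵀ`. -/
theorem fundamentalForm_eq (h : AdmissibleCoefficients c b₁ lam mu) (hg : IsMetricOn U g)
    (hy : y ∈ phaseSet U) (X Y : PhaseCoord n) :
    fundamentalForm (G c b₁ lam mu g) (J c b₁ g) y X Y =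
      vertPart g y X ⬝ᵥ (formMatrix lam mu g y *ᵥ horizPart Y)
        - vertPart g y Y ⬝ᵥ (formMatrix lam mu g y *ᵥ horizPart X) := by
  have h₁ : G1Matrix c b₁ lam mu g y * J2Matrix c b₁ g y = (formMatrix lam mu g y)ᵀ := by
    rw [← G1Matrix_transpose hg, ← J2Matrix_transpose hg, ← Matrix.transpose_mul,
      G1Matrix_eq_mul h hg hy, ← Matrix.mul_assoc, J2Matrix_mul_J1Matrix h hg hy, Matrix.one_mul]
  have h₂ : G2Matrix c b₁ lam mu g y * J1Matrix c b₁ g y = formMatrix lam mu g y := by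
    rw [G2Matrix_eq_mul h hg hy, Matrix.mul_assoc, J2Matrix_mul_J1Matrix h hg hy, Matrix.mul_one]
  rw [fundamentalForm, G_apply, horizPart_J hg, vertPart_J hg, Matrix.mulVec_neg,
    Matrix.mulVec_mulVec, Matrix.mulVec_mulVec, h₁, h₂, Matrix.mulVec_transpose, dotProduct_neg,
    dotProduct_comm (horizPart X), ← Matrix.dotProduct_mulVec]
  ring

end Components

/-! ### Positive definiteness of `G`. -/

section Positivity

variable {n : ℕ} {c : ℝ} {b₁ lam mu : ℝ → ℝ} {U : Set (Coord n)}
  {g : Coord n → Matrix (Fin n) (Fin n) ℝ} {y : PhaseCoord n} {q : Coord n}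

theorem IsMetricOn.scalarProd_sq_le (hg : IsMetricOn U g) (hq : q ∈ U) (u v : Fin n → ℝ) :
    scalarProd g q u v ^ 2 ≤ scalarProd g q u u * scalarProd g q v v := by
  by_cases hv : v = 0
  · subst hv
    simp [scalarProd_eq_dotProduct]
  have hvv := hg.pos q hq v hv
  have h0 : ∀ w, 0 ≤ scalarProd g q w w := by
    intro w
    by_cases hw : w = 0
    · subst hw
      simp [scalarProd_eq_dotProduct]
    · exact (hg.pos q hq w hw).le
  -- The component of `u` orthogonal to `v`, scaled by `|v|²` to avoid division.
  have h1 := h0 (scalarProd g q v v • u + (-scalarProd g q u v) • v)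
  simp only [scalarProd_add_left, scalarProd_add_right, scalarProd_smul_left,
    scalarProd_smul_right, hg.scalarProd_comm v u] at h1
  have h2 : 0 ≤ scalarProd g q v v *
      (scalarProd g q u u * scalarProd g q v v - scalarProd g q u v ^ 2) := by
    nlinarith [h1]
  have := nonneg_of_mul_nonneg_right h2 hvv
  linarith

/-- For `d < 0` the expression is at least `(a + 2td) N`. In the application `N = |u|²`, `m = p ·
u`, and `hm` is Cauchy–Schwarz. -/
theorem quadratic_pos {a d t N m : ℝ} (ha : 0 < a) (had : 0 < a + 2 * t * d) (hN : 0 < N)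
    (hm : m ^ 2 ≤ 2 * t * N) : 0 < a * N + d * m ^ 2 := by
  rcases le_or_gt 0 d with hd | hd
  · have := mul_pos ha hN
    have := mul_nonneg hd (sq_nonneg m)
    linarith
  · have := mul_pos had hN
    have := mul_le_mul_of_nonpos_left hm hd.le
    linarith

/-- In the direction of `p` the blocks have eigenvalues `λ + 2tμ` times, respectively divided by,
`√(2t) (√c + √(2t) b₁)`; on the orthogonal complement they are `c₁` and `c₂`. -/
theorem G_pos (h : AdmissibleCoefficients c b₁ lam mu) (hg : IsMetricOn U g)
    (hy : y ∈ phaseSet U) {X : PhaseCoord n} (hX : X ≠ 0) : 0 < G c b₁ lam mu g y X X := by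
  have ht := hg.energy_pos hy
  have hA := h.denominator_pos ht
  have ha : 0 < √c := Real.sqrt_pos.2 h.c_pos
  have hw : 0 < √(2 * energy g y) := Real.sqrt_pos.2 (by positivity)
  have hw2 : √(2 * energy g y) ^ 2 = 2 * energy g y := Real.sq_sqrt (by positivity)
  have hl := h.lam_pos _ ht
  have hlm := h.lam_mu_pos _ ht
  have hrr : scalarProd g y.1 (raised g y) (raised g y) = 2 * energy g y := by
    rw [scalarProd_eq_dotProduct, hg.mulVec_raised hy, IsMetricOn.raised_dotProduct]
  have hG1 : ∀ u : Fin n → ℝ, u ≠ 0 → 0 < u ⬝ᵥ (G1Matrix c b₁ lam mu g y *ᵥ u) := by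
    intro u hu
    have hpu : scalarProd g y.1 (raised g y) u = u ⬝ᵥ (y.2 : Fin n → ℝ) := by
      rw [hg.scalarProd_comm, scalarProd_eq_dotProduct, hg.mulVec_raised hy]
    have hCS := hg.scalarProd_sq_le hy.1 (raised g y) u
    rw [hrr, hpu] at hCS
    have hq := quadratic_pos (a := coefC1 c lam (energy g y))
      (d := coefD1 c b₁ lam mu (energy g y)) ?_ ?_ (hg.pos y.1 hy.1 u hu) hCS
    · convert! hq using 1
      rw [G1Matrix_eq, Matrix.add_mulVec, Matrix.smul_mulVec, Matrix.smul_mulVec,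
        Matrix.vecMulVec_mulVec, scalarProd_eq_dotProduct]
      simp only [dotProduct_add, dotProduct_smul, smul_eq_mul, op_smul_eq_smul]
      rw [dotProduct_comm u (y.2 : Fin n → ℝ)]
      ring
    · exact mul_pos (h.sqrt_pos ht) hl
    · rw [coefC1, coefD1, h.sqrt_eq]
      have : √c * √(2 * energy g y) * lam (energy g y) + 2 * energy g y *
          (b₁ (energy g y) * lam (energy g y) + √(2 * energy g y) *
            (√c + √(2 * energy g y) * b₁ (energy g y)) * mu (energy g y))
          = √(2 * energy g y) * (√c + √(2 * energy g y) * b₁ (energy g y)) *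
            (lam (energy g y) + 2 * energy g y * mu (energy g y)) := by
        generalize √(2 * energy g y) = w at hw2 ⊢
        rw [← hw2]; ring
      rw [this]
      positivity
  have hG2 : ∀ u : Fin n → ℝ, u ≠ 0 → 0 < u ⬝ᵥ (G2Matrix c b₁ lam mu g y *ᵥ u) := by
    intro u hu
    -- The block `G₂` acts on covectors; raising the index of `u` allows Cauchy–Schwarz for `g`
    -- itself.
    set v := (g y.1)⁻¹ *ᵥ u with hv
    have hgv : g y.1 *ᵥ v = u := by
      rw [hv, Matrix.mulVec_mulVec, hg.mul_inv hy.1, Matrix.one_mulVec]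
    have hv0 : v ≠ 0 := by
      intro h0
      rw [h0, Matrix.mulVec_zero] at hgv
      exact hu hgv.symm
    have hru : scalarProd g y.1 (raised g y) v = raised g y ⬝ᵥ u := by
      rw [scalarProd_eq_dotProduct, hgv]
    have hCS := hg.scalarProd_sq_le hy.1 (raised g y) v
    rw [hrr, hru] at hCS
    have hq := quadratic_pos (a := coefC2 c lam (energy g y))
      (d := coefD2 c b₁ lam mu (energy g y)) ?_ ?_ (hg.pos y.1 hy.1 v hv0) hCS
    · convert! hq using 1
      rw [G2Matrix_eq, Matrix.add_mulVec, Matrix.smul_mulVec, Matrix.smul_mulVec,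
        Matrix.vecMulVec_mulVec, scalarProd_eq_dotProduct, hgv, ← hv]
      simp only [dotProduct_add, dotProduct_smul, smul_eq_mul, op_smul_eq_smul]
      rw [dotProduct_comm u v, dotProduct_comm u (raised g y)]
      ring
    · exact div_pos hl (h.sqrt_pos ht)
    · have : coefC2 c lam (energy g y) + 2 * energy g y * coefD2 c b₁ lam mu (energy g y)
          = (lam (energy g y) + 2 * energy g y * mu (energy g y)) /
            (√(2 * energy g y) * (√c + √(2 * energy g y) * b₁ (energy g y))) := by
        rw [coefC2, coefD2, h.sqrt_eq]
        have e : 2 * √c * energy g y = √c * √(2 * energy g y) ^ 2 := by rw [hw2]; ring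
        rw [e]
        generalize √(2 * energy g y) = w at hw hw2 hA ⊢
        rw [← hw2]
        field_simp
        ring
      rw [this]
      positivity
  rw [G_apply]
  by_cases h1 : horizPart X = 0
  · have h2 : vertPart g y X ≠ 0 := by
      intro h2
      apply hX
      refine eq_of_components (g := g) (y := y) ?_ ?_
      · rw [h1]; ext i; simp [horizPart]
      · rw [h2]; ext i; simp [vertPart]
    rw [h1, zero_dotProduct, zero_add]
    exact hG2 _ h2
  · have := hG1 _ h1
    by_cases h2 : vertPart g y X = 0
    · rw [h2, zero_dotProduct, add_zero]
      exact this
    · exact add_pos this (hG2 _ h2)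

end Positivity

/-! ### Smoothness of `J` and `G`. -/

section Smoothness

variable {n : ℕ} {c : ℝ} {b₁ lam mu : ℝ → ℝ} {U : Set (Coord n)}
  {g : Coord n → Matrix (Fin n) (Fin n) ℝ} {y : PhaseCoord n}

theorem IsMetricOn.contDiffOn_comp_energy (hg : IsMetricOn U g) {f : ℝ → ℝ}
    (hf : ContDiffOn ℝ ∞ f (Set.Ioi 0)) :
    ContDiffOn ℝ ∞ (fun y => f (energy g y)) (phaseSet U) :=
  hf.comp hg.contDiffOn_energy fun _ hy => hg.energy_pos hy

theorem contDiffOn_J1 (h : AdmissibleCoefficients c b₁ lam mu) (hg : IsMetricOn U g)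
    (i j : Fin n) : ContDiffOn ℝ ∞ (fun y => J1 c b₁ g y i j) (phaseSet U) :=
  ((hg.contDiffOn_comp_energy h.contDiffOn_sqrt).mul
    (IsMetricOn.contDiffOn_comp_fst (hg.smooth i j))).add
    (((hg.contDiffOn_comp_energy h.smooth_b₁).mul (IsMetricOn.contDiffOn_momentum i)).mul
      (IsMetricOn.contDiffOn_momentum j))

theorem contDiffOn_sqrt_two_mul : ContDiffOn ℝ ∞ (fun t => √(2 * t)) (Set.Ioi 0) := by
  refine ContDiffOn.sqrt (contDiffOn_const.mul contDiffOn_id) fun x hx => ?_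
  have : 0 < x := hx
  change 2 * x ≠ 0
  positivity

theorem AdmissibleCoefficients.contDiffOn_denominator (h : AdmissibleCoefficients c b₁ lam mu) :
    ContDiffOn ℝ ∞ (fun t => √c + √(2 * t) * b₁ t) (Set.Ioi 0) :=
  contDiffOn_const.add (contDiffOn_sqrt_two_mul.mul h.smooth_b₁)

theorem AdmissibleCoefficients.denominator_ne_zero (h : AdmissibleCoefficients c b₁ lam mu)
    {t : ℝ} (ht : 0 < t) : 2 * √c * t * (√c + √(2 * t) * b₁ t) ≠ 0 := by
  have := h.denominator_pos ht
  have : 0 < √c := Real.sqrt_pos.2 h.c_pos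
  positivity

theorem contDiffOn_J2 (h : AdmissibleCoefficients c b₁ lam mu) (hg : IsMetricOn U g)
    (i j : Fin n) : ContDiffOn ℝ ∞ (fun y => J2 c b₁ g y i j) (phaseSet U) := by
  have h₁ : ContDiffOn ℝ ∞ (fun t => 1 / √(2 * c * t)) (Set.Ioi 0) :=
    contDiffOn_const.div h.contDiffOn_sqrt fun t ht => (h.sqrt_pos ht).ne'
  have h₂ : ContDiffOn ℝ ∞ (fun t => b₁ t / (2 * √c * t * (√c + √(2 * t) * b₁ t)))
      (Set.Ioi 0) :=
    h.smooth_b₁.div ((contDiffOn_const.mul contDiffOn_id).mul h.contDiffOn_denominator)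
      fun t ht => h.denominator_ne_zero ht
  exact ((hg.contDiffOn_comp_energy h₁).mul
    (IsMetricOn.contDiffOn_comp_fst (hg.contDiffOn_inv i j))).sub
    (((hg.contDiffOn_comp_energy h₂).mul (hg.contDiffOn_raised i)).mul (hg.contDiffOn_raised j))

theorem contDiffOn_G1 (h : AdmissibleCoefficients c b₁ lam mu) (hg : IsMetricOn U g)
    (i j : Fin n) : ContDiffOn ℝ ∞ (fun y => G1 c b₁ lam mu g y i j) (phaseSet U) := by
  have h₁ : ContDiffOn ℝ ∞ (coefC1 c lam) (Set.Ioi 0) := h.contDiffOn_sqrt.mul h.smooth_lam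
  have h₂ : ContDiffOn ℝ ∞ (coefD1 c b₁ lam mu) (Set.Ioi 0) :=
    (h.smooth_b₁.mul h.smooth_lam).add
      ((contDiffOn_sqrt_two_mul.mul h.contDiffOn_denominator).mul h.smooth_mu)
  exact ((hg.contDiffOn_comp_energy h₁).mul
    (IsMetricOn.contDiffOn_comp_fst (hg.smooth i j))).add
    (((hg.contDiffOn_comp_energy h₂).mul (IsMetricOn.contDiffOn_momentum i)).mul
      (IsMetricOn.contDiffOn_momentum j))

theorem contDiffOn_G2 (h : AdmissibleCoefficients c b₁ lam mu) (hg : IsMetricOn U g)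
    (i j : Fin n) : ContDiffOn ℝ ∞ (fun y => G2 c b₁ lam mu g y i j) (phaseSet U) := by
  have h₁ : ContDiffOn ℝ ∞ (coefC2 c lam) (Set.Ioi 0) :=
    h.smooth_lam.div h.contDiffOn_sqrt fun t ht => (h.sqrt_pos ht).ne'
  have h₂ : ContDiffOn ℝ ∞ (coefD2 c b₁ lam mu) (Set.Ioi 0) :=
    ((h.smooth_b₁.mul h.smooth_lam).neg.add (h.contDiffOn_sqrt.mul h.smooth_mu)).div
      ((contDiffOn_const.mul contDiffOn_id).mul h.contDiffOn_denominator)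
      fun t ht => h.denominator_ne_zero ht
  exact ((hg.contDiffOn_comp_energy h₁).mul
    (IsMetricOn.contDiffOn_comp_fst (hg.contDiffOn_inv i j))).add
    (((hg.contDiffOn_comp_energy h₂).mul (hg.contDiffOn_raised i)).mul (hg.contDiffOn_raised j))

theorem contDiffOn_Dp (hg : IsMetricOn U g) (i : Fin n) :
    ContDiffOn ℝ ∞ (fun y => Dp g y i) (phaseSet U) :=
  contDiffOn_const.sub (ContDiffOn.sum fun j _ =>
    (hg.contDiffOn_christoffelZero i j).smul contDiffOn_const)

theorem contDiffOn_horiz (hg : IsMetricOn U g) (i : Fin n) :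
    ContDiffOn ℝ ∞ (fun y => horiz g y i) (phaseSet U) :=
  contDiffOn_const.add (ContDiffOn.sum fun j _ =>
    (hg.contDiffOn_christoffelZero i j).smul contDiffOn_const)

theorem contDiffOn_J (h : AdmissibleCoefficients c b₁ lam mu) (hg : IsMetricOn U g) :
    ContDiffOn ℝ ∞ (J c b₁ g) (phaseSet U) :=
  (ContDiffOn.sum fun i _ => ContDiffOn.sum fun j _ =>
    (contDiffOn_J1 h hg i j).smul contDiffOn_const).sub
  (ContDiffOn.sum fun i _ => ContDiffOn.sum fun j _ =>
    (contDiffOn_J2 h hg i j).smul ((contDiffOn_Dp hg i).smulRight (contDiffOn_horiz hg j)))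

set_option maxSynthPendingDepth 3 in
theorem contDiffOn_G (h : AdmissibleCoefficients c b₁ lam mu) (hg : IsMetricOn U g) :
    ContDiffOn ℝ ∞ (G c b₁ lam mu g) (phaseSet U) :=
  (ContDiffOn.sum fun i _ => ContDiffOn.sum fun j _ =>
    (contDiffOn_G1 h hg i j).smul contDiffOn_const).add
  (ContDiffOn.sum fun i _ => ContDiffOn.sum fun j _ =>
    (contDiffOn_G2 h hg i j).smul ((contDiffOn_Dp hg i).smulRight (contDiffOn_Dp hg j)))

end Smoothness

/-! ### Integrability of `J`. -/

section Integrability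

variable {n : ℕ} {c : ℝ} {b₁ lam mu : ℝ → ℝ} {U : Set (Coord n)}
  {g : Coord n → Matrix (Fin n) (Fin n) ℝ} {y : PhaseCoord n}

theorem differentiableAt_of_contDiffOn_Ioi {f : ℝ → ℝ} (hf : ContDiffOn ℝ ∞ f (Set.Ioi 0))
    {t : ℝ} (ht : 0 < t) : DifferentiableAt ℝ f t :=
  (hf.contDiffAt (Ioi_mem_nhds ht)).differentiableAt (by norm_num)

theorem fderiv_J1 (h : AdmissibleCoefficients c b₁ lam mu) (hg : IsMetricOn U g)
    (hy : y ∈ phaseSet U) (i l : Fin n) (X : PhaseCoord n) :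
    fderiv ℝ (fun z => J1 c b₁ g z i l) y X =
      (c / √(2 * c * energy g y) * g y.1 i l
        + deriv b₁ (energy g y) * y.2 i * y.2 l) * fderiv ℝ (energy g) y X
      + √(2 * c * energy g y) * fderiv ℝ (fun x => g x i l) y.1 X.1
      + b₁ (energy g y) * (X.2 i * y.2 l + y.2 i * X.2 l) := by
  have ht := hg.energy_pos hy
  have d₁ := hg.differentiableAt_phase hy (hg.contDiffOn_comp_energy h.contDiffOn_sqrt)
  have d₂ := hg.differentiableAt_phase hy (IsMetricOn.contDiffOn_comp_fst (hg.smooth i l))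
  have d₃ := hg.differentiableAt_phase hy (hg.contDiffOn_comp_energy h.smooth_b₁)
  have d₄ := fun i => hg.differentiableAt_phase hy (IsMetricOn.contDiffOn_momentum (U := U) i)
  have d₅ := hg.differentiableAt_phase hy hg.contDiffOn_energy
  unfold J1
  rw [fderiv_add_eq (d₁.fun_mul d₂) ((d₃.fun_mul (d₄ i)).fun_mul (d₄ l)),
    fderiv_mul_eq d₁ d₂, fderiv_mul_eq (d₃.fun_mul (d₄ i)) (d₄ l),
    fderiv_mul_eq d₃ (d₄ i), IsMetricOn.fderiv_momentum, IsMetricOn.fderiv_momentum,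
    hg.fderiv_comp_fst hy (hg.smooth i l),
    fderiv_scalar_comp_eq (differentiableAt_of_contDiffOn_Ioi h.smooth_b₁ ht) d₅,
    fderiv_scalar_comp_eq (s := fun x => √(2 * c * x)) (h.hasDerivAt_sqrt ht).differentiableAt d₅,
    (h.hasDerivAt_sqrt ht).deriv]
  ring

/-- The tensor `J₁` is parallel along horizontal directions, being built from `g`, `p` and functions
of `t`, which all are. -/
theorem fderiv_J1_horiz (h : AdmissibleCoefficients c b₁ lam mu) (hg : IsMetricOn U g)
    (hy : y ∈ phaseSet U) (i l j : Fin n) :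
    fderiv ℝ (fun z => J1 c b₁ g z i l) y (horiz g y j) =
      ∑ m, (christoffel g m j i y.1 * J1 c b₁ g y m l
        + J1 c b₁ g y i m * christoffel g m j l y.1) := by
  have hm : fderiv ℝ (fun x => g x i l) y.1 (stdVec j) = _ := hg.pderiv_metric hy.1 j i l
  rw [fderiv_J1 h hg hy, hg.fderiv_energy_horiz hy, horiz_fst, horiz_snd, horiz_snd, hm]
  simp only [J1, christoffelZero, mul_add, Finset.mul_sum, Finset.sum_mul, mul_zero, zero_add,
    ← Finset.sum_add_distrib]
  exact Finset.sum_congr rfl fun m _ => by ring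

/-- The bracket of the vertical fields `J (δ/δqⁱ)` and `J (δ/δqʲ)`. -/
theorem sum_J1_mul_fderiv_J1_sub (h : AdmissibleCoefficients c b₁ lam mu) (hg : IsMetricOn U g)
    (hy : y ∈ phaseSet U) (i j l : Fin n) :
    ∑ k, J1 c b₁ g y i k * fderiv ℝ (fun z => J1 c b₁ g z j l) y (vert k)
      - ∑ k, J1 c b₁ g y j k * fderiv ℝ (fun z => J1 c b₁ g z i l) y (vert k)
      = c * (y.2 i * g y.1 j l - y.2 j * g y.1 i l) := by
  have ht := hg.energy_pos hy
  have hc := h.c_pos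
  have hs : 0 < √(2 * c * energy g y) := h.sqrt_pos ht
  have hs2 : √(2 * c * energy g y) ^ 2 = 2 * c * energy g y := Real.sq_sqrt (by positivity)
  have hr : ∀ i, ∑ k, J1 c b₁ g y i k * raised g y k =
      (√(2 * c * energy g y) + 2 * energy g y * b₁ (energy g y)) * y.2 i := by
    intro i
    have e₁ := hg.mulVec_raised_apply hy i
    have e₂ := IsMetricOn.energy_eq g y
    have : ∀ k, J1 c b₁ g y i k * raised g y k =
        √(2 * c * energy g y) * (g y.1 i k * raised g y k)
          + b₁ (energy g y) * y.2 i * (raised g y k * y.2 k) := fun k => by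
      rw [J1]; ring
    simp only [this, Finset.sum_add_distrib, ← Finset.mul_sum]
    rw [e₁, show ∑ k, raised g y k * y.2 k = 2 * energy g y by linarith]
    ring
  have hv : ∀ i j l, ∑ k, J1 c b₁ g y i k * fderiv ℝ (fun z => J1 c b₁ g z j l) y (vert k) =
      (c / √(2 * c * energy g y) * g y.1 j l + deriv b₁ (energy g y) * y.2 j * y.2 l) *
        ((√(2 * c * energy g y) + 2 * energy g y * b₁ (energy g y)) * y.2 i)
      + b₁ (energy g y) * (J1 c b₁ g y i j * y.2 l + y.2 j * J1 c b₁ g y i l) := by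
    intro i j l
    have e : ∀ k, J1 c b₁ g y i k * fderiv ℝ (fun z => J1 c b₁ g z j l) y (vert k) =
        (c / √(2 * c * energy g y) * g y.1 j l + deriv b₁ (energy g y) * y.2 j * y.2 l) *
          (J1 c b₁ g y i k * raised g y k)
        + b₁ (energy g y) * (J1 c b₁ g y i k * (if k = j then 1 else 0) * y.2 l
          + y.2 j * (J1 c b₁ g y i k * (if k = l then 1 else 0))) := by
      intro k
      rw [fderiv_J1 h hg hy, hg.fderiv_energy_vert hy]
      simp only [vert_fst, vert_snd, map_zero, stdVec_apply]
      ring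
    simp only [e, Finset.sum_add_distrib, ← Finset.mul_sum, hr, ← Finset.sum_mul]
    simp
  rw [hv, hv]
  simp only [J1, hg.symm y.1 j i]
  -- The terms in `b₁'` are symmetric in `i, j` and cancel. With `s = √(2ct)` the remaining
  -- coefficient is `c + b₁ (2ct - s²) / s`; eliminating `t` through `s` makes it visibly `c`.
  have hE : energy g y = √(2 * c * energy g y) ^ 2 / (2 * c) := by
    rw [hs2]; field_simp
  generalize √(2 * c * energy g y) = s at hs hE ⊢
  generalize b₁ (energy g y) = b at hE ⊢
  generalize deriv b₁ (energy g y) = b' at hE ⊢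
  rw [hE]
  field_simp
  ring

theorem fderiv_sum_smul_vert {f : Fin n → PhaseCoord n → ℝ}
    (hf : ∀ l, DifferentiableAt ℝ (f l) y) (X : PhaseCoord n) :
    fderiv ℝ (fun z => ∑ l, f l z • (vert l : PhaseCoord n)) y X =
      ∑ l, fderiv ℝ (f l) y X • vert l := by
  rw [fderiv_fun_sum fun l _ => (hf l).smul_const _]
  simp only [sum_apply]
  refine Finset.sum_congr rfl fun l _ => ?_
  rw [fderiv_smul_const (hf l)]
  rfl

theorem J_horiz (hg : IsMetricOn U g) (z : PhaseCoord n) (i : Fin n) :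
    J c b₁ g z (horiz g z i) = ∑ l, J1 c b₁ g z i l • vert l := by
  rw [J_apply]
  simp [hg.Dp_horiz]

theorem J_vert (z : PhaseCoord n) (i : Fin n) :
    J c b₁ g z (vert i) = -∑ l, J2 c b₁ g z i l • horiz g z l := by
  rw [J_apply]
  simp

/-- The only place where the curvature enters: the vertical brackets `[Jδ_i, Jδ_j]` must reproduce
the curvature bracket `[δ_i, δ_j]`. -/
theorem nijenhuis_horiz (h : AdmissibleCoefficients c b₁ lam mu) (hg : IsMetricOn U g)
    (hy : y ∈ phaseSet U) (hsec : ∀ u v : Fin n → ℝ, LinearIndependent ℝ ![u, v] →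
      sectionalCurvature g y.1 u v = c) (i j : Fin n) :
    nijenhuis (J c b₁ g) (fun z => horiz g z i) (fun z => horiz g z j) y = 0 := by
  have d₁ := fun i l => hg.differentiableAt_phase hy (contDiffOn_J1 h hg i l)
  have d₂ := fun i l => hg.differentiableAt_phase hy (hg.contDiffOn_christoffelZero i l)
  have hDJ : ∀ i X, fderiv ℝ (fun z => ∑ l, J1 c b₁ g z i l • (vert l : PhaseCoord n)) y X =
      ∑ l, fderiv ℝ (fun z => J1 c b₁ g z i l) y X • vert l :=
    fun i X => fderiv_sum_smul_vert (d₁ i) X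
  have hDH : ∀ i X, fderiv ℝ (fun z => horiz g z i) y X =
      ∑ l, fderiv ℝ (fun z => christoffelZero g z i l) y X • vert l := by
    intro i X
    unfold horiz
    rw [fderiv_const_add]
    exact fderiv_sum_smul_vert (d₂ i) X
  have hsum : ∀ (f : PhaseCoord n → ℝ) i, fderiv ℝ f y (∑ k, J1 c b₁ g y i k • vert k) =
      ∑ k, J1 c b₁ g y i k * fderiv ℝ f y (vert k) := by
    intro f i
    simp
  -- This is `[Jδ_i, δ_j] + [δ_i, Jδ_j] = 0`. As `J₁` is parallel, the first bracket reduces to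
  -- `-Γ^m_{ji} J₁_{ml}`, the second to its opposite with `i, j` exchanged, and `Γ` is symmetric.
  have hmix : (∑ l, fderiv ℝ (fun z => christoffelZero g z j l) y
        (∑ k, J1 c b₁ g y i k • vert k) • (vert l : PhaseCoord n)
      - ∑ l, fderiv ℝ (fun z => J1 c b₁ g z i l) y (horiz g y j) • vert l)
      + (∑ l, fderiv ℝ (fun z => J1 c b₁ g z j l) y (horiz g y i) • vert l
      - ∑ l, fderiv ℝ (fun z => christoffelZero g z i l) y
        (∑ k, J1 c b₁ g y j k • vert k) • vert l) = 0 := by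
    simp only [← Finset.sum_sub_distrib, ← Finset.sum_add_distrib, ← sub_smul, ← add_smul]
    refine Finset.sum_eq_zero fun l _ => ?_
    rw [hsum, hsum, fderiv_J1_horiz h hg hy, fderiv_J1_horiz h hg hy]
    simp only [hg.fderiv_christoffelZero_vert hy, Finset.sum_add_distrib,
      hg.christoffel_symm y.1 _ j i]
    rw [show ∀ a b c d : ℝ, a - (b + a) + (b + d - d) = 0 from fun a b c d => by ring]
    · exact zero_smul _ _
    · exact 0
  have hJH : ∀ u v w z : PhaseCoord n, (u - v) + (w - z) = 0 →
      J c b₁ g y (u - v) + J c b₁ g y (w - z) = 0 := by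
    intro u v w z h0
    rw [← map_add, h0, map_zero]
  simp only [nijenhuis, VectorField.lieBracket, hDJ, hDH, J_horiz hg]
  have hm := hJH _ _ _ _ hmix
  have hcancel : ∀ A B C D : PhaseCoord n, B + C = 0 → A - B - C - D = A - D := by
    intro A B C D h0
    rw [sub_sub A B C, h0, sub_zero]
  rw [hcancel _ _ _ _ hm]
  simp only [← Finset.sum_sub_distrib, ← sub_smul]
  refine Finset.sum_eq_zero fun l _ => ?_
  rw [hsum, hsum, sum_J1_mul_fderiv_J1_sub h hg hy,
    hg.fderiv_christoffelZero_horiz_sub hy h.c_pos.ne' hsec, sub_self, zero_smul]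

theorem eq_sum_frame (hg : IsMetricOn U g) (y X : PhaseCoord n) :
    X = ∑ i, dq i X • horiz g y i + ∑ i, Dp g y i X • vert i := by
  refine eq_of_components (g := g) (y := y) ?_ ?_
  · ext k
    simp [horizPart, Prod.fst_sum]
  · ext k
    simp only [vertPart, map_add, map_sum, map_smul, hg.Dp_horiz, Dp_vert]
    simp

theorem span_horiz_union_J_horiz (h : AdmissibleCoefficients c b₁ lam mu) (hg : IsMetricOn U g)
    (hy : y ∈ phaseSet U) :
    Submodule.span ℝ (Set.range (fun i => horiz g y i) ∪
      Set.range fun i => J c b₁ g y (horiz g y i)) = ⊤ := by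
  set S := Submodule.span ℝ (Set.range (fun i => horiz g y i) ∪
      Set.range fun i => J c b₁ g y (horiz g y i)) with hS
  have hH : ∀ i, horiz g y i ∈ S := fun i => Submodule.subset_span (Or.inl ⟨i, rfl⟩)
  have hJH : ∀ i, J c b₁ g y (horiz g y i) ∈ S := fun i => Submodule.subset_span (Or.inr ⟨i, rfl⟩)
  have hV : ∀ i, (vert i : PhaseCoord n) ∈ S := by
    intro i
    -- Apply `J` to `J (∂/∂p_i) = -J₂^{il} δ/δq^l`.
    have e : (vert i : PhaseCoord n) = ∑ l, J2 c b₁ g y i l • J c b₁ g y (horiz g y l) := by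
      have := J_sq h hg hy (vert i)
      rw [J_vert, map_neg, map_sum, neg_inj] at this
      simpa using this.symm
    rw [e]
    exact Submodule.sum_mem _ fun l _ => Submodule.smul_mem _ _ (hJH l)
  rw [eq_top_iff]
  intro X _
  rw [eq_sum_frame hg y X]
  exact Submodule.add_mem _ (Submodule.sum_mem _ fun i _ => Submodule.smul_mem _ _ (hH i))
    (Submodule.sum_mem _ fun i _ => Submodule.smul_mem _ _ (hV i))

theorem isHermitianOn (h : AdmissibleCoefficients c b₁ lam mu) (hg : IsMetricOn U g)
    (hsec : ∀ q ∈ U, ∀ u v : Fin n → ℝ, LinearIndependent ℝ ![u, v] →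
      sectionalCurvature g q u v = c) :
    IsHermitianOn (phaseSet U) (G c b₁ lam mu g) (J c b₁ g) where
  smooth_metric := contDiffOn_G h hg
  symm _ _ X Y := G_symm hg X Y
  pos _ hy _ hX := G_pos h hg hy hX
  smooth_complex := contDiffOn_J h hg
  sq_eq_neg_one _ hy X := J_sq h hg hy X
  integrable _ _ hX hY _ hy := nijenhuis_eq_zero_of_frame
    (hg.differentiableAt_phase hy (contDiffOn_J h hg))
    (((isOpen_phaseSet hg.isOpen).eventually_mem hy).mono fun _ hz => J_sq h hg hz)
    (fun i => hg.differentiableAt_phase hy (contDiffOn_horiz hg i))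
    (span_horiz_union_J_horiz h hg hy) (nijenhuis_horiz h hg hy (hsec _ hy.1))
    (hg.differentiableAt_phase hy hX) (hg.differentiableAt_phase hy hY)
  compatible _ hy X Y := G_J_J h hg hy X Y

end Integrability

/-! ### Closedness of the fundamental form. -/

section Kaehler

variable {n : ℕ} {c : ℝ} {b₁ lam mu : ℝ → ℝ} {U : Set (Coord n)}
  {g : Coord n → Matrix (Fin n) (Fin n) ℝ} {y : PhaseCoord n}

/-- The Liouville form `p_i dqⁱ`. -/
def liouville {n : ℕ} (y : PhaseCoord n) : PhaseCoord n →L[ℝ] ℝ := ∑ i, y.2 i • dq i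

/-- The canonical symplectic form `dp_i ∧ dqⁱ`. -/
def symplecticForm {n : ℕ} (X Y : PhaseCoord n) : ℝ := ∑ i, (X.2 i * Y.1 i - Y.2 i * X.1 i)

/-- The differential form `f(t) p_i dqⁱ`. -/
def scaledLiouville {n : ℕ} (g : Coord n → Matrix (Fin n) (Fin n) ℝ) (f : ℝ → ℝ)
    (y : PhaseCoord n) : PhaseCoord n [⋀^Fin 1]→L[ℝ] ℝ :=
  f (energy g y) • ContinuousAlternatingMap.ofSubsingleton ℝ (PhaseCoord n) ℝ (0 : Fin 1)
    (liouville y)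

theorem liouville_apply (y X : PhaseCoord n) : liouville y X = ∑ i, y.2 i * X.1 i := by
  simp [liouville]

theorem scaledLiouville_apply (f : ℝ → ℝ) (v : Fin 1 → PhaseCoord n) :
    scaledLiouville g f y v = f (energy g y) * liouville y (v 0) := by
  simp [scaledLiouville]

theorem contDiffOn_liouville : ContDiffOn ℝ ∞ (liouville (n := n)) (phaseSet U) :=
  ContDiffOn.sum fun i _ => (IsMetricOn.contDiffOn_momentum i).smul contDiffOn_const

theorem contDiffOn_scaledLiouville (hg : IsMetricOn U g) {f : ℝ → ℝ}
    (hf : ContDiffOn ℝ ∞ f (Set.Ioi 0)) :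
    ContDiffOn ℝ ∞ (scaledLiouville g f) (phaseSet U) := by
  refine (hg.contDiffOn_comp_energy hf).smul ?_
  exact (ContinuousAlternatingMap.ofSubsingletonLIE (𝕜 := ℝ) (E := PhaseCoord n) (F := ℝ)
    (0 : Fin 1)).contDiff.comp_contDiffOn contDiffOn_liouville

theorem fderiv_liouville_apply (hg : IsMetricOn U g) (hy : y ∈ phaseSet U) (X Y : PhaseCoord n) :
    fderiv ℝ (fun z => liouville z Y) y X = ∑ i, X.2 i * Y.1 i := by
  have d := fun i => hg.differentiableAt_phase hy (IsMetricOn.contDiffOn_momentum (U := U) i)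
  simp only [liouville_apply]
  rw [fderiv_sum_eq _ fun i => (d i).fun_mul (differentiableAt_const _)]
  refine Finset.sum_congr rfl fun i _ => ?_
  rw [fderiv_mul_eq (d i) (differentiableAt_const _), IsMetricOn.fderiv_momentum]
  simp

theorem extDeriv_scaledLiouville (hg : IsMetricOn U g) (hy : y ∈ phaseSet U) {f : ℝ → ℝ}
    (hf : ContDiffOn ℝ ∞ f (Set.Ioi 0)) (X Y : PhaseCoord n) :
    extDeriv (scaledLiouville g f) y ![X, Y] =
      f (energy g y) * symplecticForm X Y + deriv f (energy g y) *
        (fderiv ℝ (energy g) y X * liouville y Y - fderiv ℝ (energy g) y Y * liouville y X) := by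
  have d₁ := hg.differentiableAt_phase hy (hg.contDiffOn_comp_energy hf)
  have d₂ := fun X => hg.differentiableAt_phase hy
    ((contDiffOn_liouville (U := U)).clm_apply (contDiffOn_const (c := X)))
  have d₃ := hg.differentiableAt_phase hy hg.contDiffOn_energy
  have e : ∀ X Y, fderiv ℝ (fun z => f (energy g z) * liouville z Y) y X =
      deriv f (energy g y) * fderiv ℝ (energy g) y X * liouville y Y
        + f (energy g y) * ∑ i, X.2 i * Y.1 i := by
    intro X Y
    rw [fderiv_mul_eq d₁ (d₂ Y), fderiv_liouville_apply hg hy,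
      fderiv_scalar_comp_eq (differentiableAt_of_contDiffOn_Ioi hf (hg.energy_pos hy)) d₃]
  rw [extDeriv_apply (hg.differentiableAt_phase hy (contDiffOn_scaledLiouville hg hf))]
  simp only [scaledLiouville_apply, Fin.removeNth]
  simp [e, symplecticForm, Finset.sum_sub_distrib]
  ring

theorem contDiffOn_extDeriv {E F : Type*} [NormedAddCommGroup E] [NormedSpace ℝ E]
    [NormedAddCommGroup F] [NormedSpace ℝ F] {k : ℕ} {α : E → E [⋀^Fin k]→L[ℝ] F} {Ω : Set E}
    (hΩ : IsOpen Ω) (hα : ContDiffOn ℝ ∞ α Ω) : ContDiffOn ℝ ∞ (extDeriv α) Ω :=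
  (ContinuousAlternatingMap.alternatizeUncurryFinCLM ℝ E F).contDiff.comp_contDiffOn
    (hα.fderiv_of_isOpen hΩ (by norm_num))

theorem extDeriv_extDeriv_eq_zero {E F : Type*} [NormedAddCommGroup E] [NormedSpace ℝ E]
    [NormedAddCommGroup F] [NormedSpace ℝ F] {k : ℕ} {α : E → E [⋀^Fin k]→L[ℝ] F} {Ω : Set E}
    (hΩ : IsOpen Ω) (hα : ContDiffOn ℝ ∞ α Ω) {x : E} (hx : x ∈ Ω) :
    extDeriv (extDeriv α) x = 0 :=
  extDeriv_extDeriv_apply (hα.contDiffAt (hΩ.mem_nhds hx))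
    (by simpa using WithTop.coe_le_coe.2 (le_top : (2 : ℕ∞) ≤ ⊤))

theorem extDeriv_two_form_apply {E F : Type*} [NormedAddCommGroup E] [NormedSpace ℝ E]
    [NormedAddCommGroup F] [NormedSpace ℝ F] {α : E → E [⋀^Fin 2]→L[ℝ] F} {x : E}
    (hα : DifferentiableAt ℝ α x) (X Y Z : E) :
    extDeriv α x ![X, Y, Z] = fderiv ℝ (fun z => α z ![Y, Z]) x X
      - fderiv ℝ (fun z => α z ![X, Z]) x Y + fderiv ℝ (fun z => α z ![X, Y]) x Z := by
  have h₀ : Fin.removeNth (0 : Fin 3) ![X, Y, Z] = ![Y, Z] := by ext i; fin_cases i <;> rfl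
  have h₁ : Fin.removeNth (1 : Fin 3) ![X, Y, Z] = ![X, Z] := by ext i; fin_cases i <;> rfl
  have h₂ : Fin.removeNth (2 : Fin 3) ![X, Y, Z] = ![X, Y] := by ext i; fin_cases i <;> rfl
  rw [extDeriv_apply hα, Fin.sum_univ_three, h₀, h₁, h₂]
  simp [sub_eq_add_neg]

/-- That is, `dt = g^{0i} Dp_i`, since horizontal vectors do not change `t`. -/
theorem fderiv_energy_eq (hg : IsMetricOn U g) (hy : y ∈ phaseSet U) (X : PhaseCoord n) :
    fderiv ℝ (energy g) y X = vertPart g y X ⬝ᵥ raised g y := by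
  conv_lhs => rw [eq_sum_frame hg y X]
  simp [hg.fderiv_energy_horiz hy, hg.fderiv_energy_vert hy, dotProduct, vertPart]

/-- The Christoffel terms of `Dp_i ∧ dqⁱ` cancel because `Γ^0_{ij}` is symmetric. -/
theorem vertPart_dotProduct_sub (hg : IsMetricOn U g) (X Y : PhaseCoord n) :
    vertPart g y X ⬝ᵥ horizPart Y - vertPart g y Y ⬝ᵥ horizPart X = symplecticForm X Y := by
  have h : ∀ X Y : PhaseCoord n, vertPart g y X ⬝ᵥ horizPart Y = ∑ i, X.2 i * Y.1 i
      - ∑ i, ∑ j, christoffelZero g y i j * X.1 j * Y.1 i := by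
    intro X Y
    simp only [vertPart, horizPart, Dp_apply, dotProduct, sub_mul, Finset.sum_sub_distrib,
      Finset.sum_mul, dq_apply]
  have hs : ∑ i, ∑ j, christoffelZero g y i j * X.1 j * Y.1 i =
      ∑ i, ∑ j, christoffelZero g y i j * Y.1 j * X.1 i := by
    rw [Finset.sum_comm]
    refine Finset.sum_congr rfl fun i _ => Finset.sum_congr rfl fun j _ => ?_
    rw [hg.christoffelZero_symm y j i]
    ring
  rw [h, h, hs, symplecticForm, Finset.sum_sub_distrib]
  ring

theorem fundamentalForm_eq_symplecticForm (h : AdmissibleCoefficients c b₁ lam mu)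
    (hg : IsMetricOn U g) (hy : y ∈ phaseSet U) (X Y : PhaseCoord n) :
    fundamentalForm (G c b₁ lam mu g) (J c b₁ g) y X Y =
      lam (energy g y) * symplecticForm X Y + mu (energy g y) *
        (fderiv ℝ (energy g) y X * liouville y Y - fderiv ℝ (energy g) y Y * liouville y X) := by
  have hM : ∀ X Y : PhaseCoord n, vertPart g y X ⬝ᵥ (formMatrix lam mu g y *ᵥ horizPart Y) =
      lam (energy g y) * (vertPart g y X ⬝ᵥ horizPart Y)
        + mu (energy g y) * (fderiv ℝ (energy g) y X * liouville y Y) := by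
    intro X Y
    have : liouville y Y = (y.2 : Fin n → ℝ) ⬝ᵥ horizPart Y := liouville_apply y Y
    rw [formMatrix, Matrix.add_mulVec, Matrix.smul_mulVec, Matrix.smul_mulVec, Matrix.one_mulVec,
      Matrix.vecMulVec_mulVec, fderiv_energy_eq hg hy, this]
    simp only [dotProduct_add, dotProduct_smul, smul_eq_mul, op_smul_eq_smul]
    ring
  rw [fundamentalForm_eq h hg hy, hM, hM, ← vertPart_dotProduct_sub (y := y) hg]
  ring

/-- If `μ = λ'`, the form is exact: `φ = d(λ(t) p_i dqⁱ)`. -/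
theorem isClosedTwoFormOn (h : AdmissibleCoefficients c b₁ lam mu) (hg : IsMetricOn U g)
    (hmu : ∀ t, 0 < t → mu t = deriv lam t) :
    IsClosedTwoFormOn (phaseSet U) (fundamentalForm (G c b₁ lam mu g) (J c b₁ g)) := by
  have hs := contDiffOn_scaledLiouville hg h.smooth_lam
  refine ⟨extDeriv (scaledLiouville g lam), contDiffOn_extDeriv (isOpen_phaseSet hg.isOpen) hs,
    fun y hy X Y => ?_, fun y hy => extDeriv_extDeriv_eq_zero (isOpen_phaseSet hg.isOpen) hs hy⟩
  rw [fundamentalForm_eq_symplecticForm h hg hy, extDeriv_scaledLiouville hg hy h.smooth_lam,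
    hmu _ (hg.energy_pos hy)]

/-- Needed for `f = μ`. The base point `1` keeps the interval of integration inside `(0, ∞)`, where
alone `f` is controlled. -/
theorem exists_antiderivative {f : ℝ → ℝ} (hf : ContDiffOn ℝ ∞ f (Set.Ioi 0)) :
    ∃ F : ℝ → ℝ, ContDiffOn ℝ ∞ F (Set.Ioi 0) ∧ ∀ t, 0 < t → deriv F t = f t := by
  have hd : ∀ t, 0 < t → HasDerivAt (fun t => ∫ x in (1 : ℝ)..t, f x) (f t) t := by
    intro t ht
    have hsub : Set.uIcc 1 t ⊆ Set.Ioi 0 := fun x hx =>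
      lt_of_lt_of_le (lt_min one_pos ht) hx.1
    refine intervalIntegral.integral_hasDerivAt_right
      (hf.continuousOn.mono hsub).intervalIntegrable ?_
      (hf.continuousOn.continuousAt (Ioi_mem_nhds ht))
    exact hf.continuousOn.stronglyMeasurableAtFilter isOpen_Ioi t ht
  refine ⟨_, ?_, fun t ht => (hd t ht).deriv⟩
  rw [contDiffOn_infty_iff_deriv_of_isOpen isOpen_Ioi]
  exact ⟨fun t ht => (hd t ht).differentiableAt.differentiableWithinAt,
    hf.congr fun t ht => (hd t ht).deriv⟩

theorem exists_ne_zero_dotProduct_eq_zero (hn : 2 ≤ n) (r : Fin n → ℝ) :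
    ∃ w : Fin n → ℝ, w ≠ 0 ∧ r ⬝ᵥ w = 0 := by
  let L : (Fin n → ℝ) →ₗ[ℝ] ℝ := dotProductBilin ℝ ℝ r
  have hk : LinearMap.ker L ≠ ⊥ := LinearMap.ker_ne_bot_of_finrank_lt (by simp; omega)
  obtain ⟨w, hw, hw0⟩ := Submodule.exists_mem_ne_zero_of_ne_bot hk
  exact ⟨w, hw0, hw⟩

/-- The energy is quadratic in `p`, so a nonzero covector can be rescaled to any prescribed energy;
thus a single fibre sees all `t > 0`. -/
theorem exists_energy_eq (hn : 2 ≤ n) (hg : IsMetricOn U g) (hU : U.Nonempty) {t : ℝ}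
    (ht : 0 < t) : ∃ y ∈ phaseSet U, energy g y = t := by
  obtain ⟨q, hq⟩ := hU
  have hp : (stdVec ⟨0, by omega⟩ : Coord n) ≠ 0 := by
    intro h0
    have := congrArg (fun v : Coord n => v ⟨0, by omega⟩) h0
    simp at this
  set p : Coord n := stdVec ⟨0, by omega⟩
  have he : 0 < energy g (q, p) := hg.energy_pos ⟨hq, hp⟩
  have ha : 0 < √(t / energy g (q, p)) := Real.sqrt_pos.2 (by positivity)
  refine ⟨(q, √(t / energy g (q, p)) • p), ⟨hq, smul_ne_zero ha.ne' hp⟩, ?_⟩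
  have hsc : ∀ a : ℝ, energy g (q, a • p) = a ^ 2 * energy g (q, p) := by
    intro a
    simp only [energy, PiLp.smul_apply, smul_eq_mul, Finset.mul_sum]
    exact Finset.sum_congr rfl fun i _ => Finset.sum_congr rfl fun k _ => by ring
  rw [hsc, Real.sq_sqrt (by positivity)]
  field_simp

/-- With `F' = μ`, the closed form `φ - d(Fθ)` equals `(λ - F) dθ`, so `(λ' - μ) dt ∧ dθ = 0`; this
is tested on three vectors. -/
theorem mu_eq_deriv_lam (hn : 2 ≤ n) (h : AdmissibleCoefficients c b₁ lam mu)
    (hg : IsMetricOn U g) (hU : U.Nonempty)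
    (hφ : IsClosedTwoFormOn (phaseSet U) (fundamentalForm (G c b₁ lam mu g) (J c b₁ g)))
    {t : ℝ} (ht : 0 < t) : mu t = deriv lam t := by
  obtain ⟨y, hy, rfl⟩ := exists_energy_eq hn hg hU ht
  obtain ⟨η, hη, hηφ, hdη⟩ := hφ
  obtain ⟨F, hF, hF'⟩ := exists_antiderivative h.smooth_mu
  have hΩ := isOpen_phaseSet hg.isOpen
  have hs := contDiffOn_scaledLiouville hg hF
  have hκ := contDiffOn_extDeriv hΩ hs
  have dη := hg.differentiableAt_phase hy hη
  have dκ := hg.differentiableAt_phase hy hκ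
  have hlF : ContDiffOn ℝ ∞ (fun t => lam t - F t) (Set.Ioi 0) := h.smooth_lam.sub hF
  have dt := hg.differentiableAt_phase hy hg.contDiffOn_energy
  have hdiff : ∀ X Y Z : PhaseCoord n, fderiv ℝ (fun z => η z ![Y, Z]) y X
      - fderiv ℝ (fun z => extDeriv (scaledLiouville g F) z ![Y, Z]) y X =
      (deriv lam (energy g y) - mu (energy g y)) * fderiv ℝ (energy g) y X
        * symplecticForm Y Z := by
    intro X Y Z
    have d₁ : DifferentiableAt ℝ (fun z => η z ![Y, Z]) y :=
      dη.continuousAlternatingMap_apply_const _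
    have d₂ : DifferentiableAt ℝ (fun z => extDeriv (scaledLiouville g F) z ![Y, Z]) y :=
      dκ.continuousAlternatingMap_apply_const _
    have he : (fun z => η z ![Y, Z] - extDeriv (scaledLiouville g F) z ![Y, Z]) =ᶠ[𝓝 y]
        fun z => (lam (energy g z) - F (energy g z)) * symplecticForm Y Z := by
      filter_upwards [hΩ.mem_nhds hy] with z hz
      rw [hηφ z hz, fundamentalForm_eq_symplecticForm h hg hz, extDeriv_scaledLiouville hg hz hF,
        hF' _ (hg.energy_pos hz)]
      ring
    have := congrArg (fun L : PhaseCoord n →L[ℝ] ℝ => L X) he.fderiv_eq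
    rw [fderiv_fun_sub d₁ d₂, sub_apply] at this
    rw [this, fderiv_mul_eq (hg.differentiableAt_phase hy (hg.contDiffOn_comp_energy hlF))
      (differentiableAt_const _), fderiv_scalar_comp_eq (s := fun t => lam t - F t)
        (differentiableAt_of_contDiffOn_Ioi hlF ht) dt,
      deriv_fun_sub (differentiableAt_of_contDiffOn_Ioi h.smooth_lam ht)
        (differentiableAt_of_contDiffOn_Ioi hF ht), hF' _ ht]
    simp
  obtain ⟨w, hw, hrw⟩ := exists_ne_zero_dotProduct_eq_zero hn (raised g y)
  have hd : ∀ v : Coord n, fderiv ℝ (energy g) y (0, v) = raised g y ⬝ᵥ (v : Fin n → ℝ) := by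
    intro v
    rw [hg.fderiv_energy hy]
    simp [dotProduct]
  have hX : fderiv ℝ (energy g) y (0, y.2) = 2 * energy g y := by
    rw [hd, IsMetricOn.raised_dotProduct]
  have hY : fderiv ℝ (energy g) y (0, WithLp.toLp 2 w) = 0 := (hd _).trans hrw
  have hXY : symplecticForm ((0, y.2) : PhaseCoord n) (0, WithLp.toLp 2 w) = 0 := by
    simp [symplecticForm]
  have hYZ : symplecticForm ((0, WithLp.toLp 2 w) : PhaseCoord n) (WithLp.toLp 2 w, 0) =
      w ⬝ᵥ w := by
    simp [symplecticForm, dotProduct]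
  -- Of the three terms of `dt ∧ dθ` on these vectors only `dt(0, p) · dθ((0, w), (w, 0)) = 2t |w|²`
  -- survives: `w` is tangent to the energy level and the fibres are Lagrangian.
  have e₁ := extDeriv_two_form_apply dη (0, y.2) (0, WithLp.toLp 2 w) (WithLp.toLp 2 w, 0)
  have e₂ := extDeriv_two_form_apply dκ (0, y.2) (0, WithLp.toLp 2 w) (WithLp.toLp 2 w, 0)
  rw [hdη y hy] at e₁
  rw [extDeriv_extDeriv_eq_zero hΩ hs hy] at e₂
  have e₃ := hdiff (0, y.2) (0, WithLp.toLp 2 w) (WithLp.toLp 2 w, 0)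
  have e₄ := hdiff (0, WithLp.toLp 2 w) (0, y.2) (WithLp.toLp 2 w, 0)
  have e₅ := hdiff (WithLp.toLp 2 w, 0) (0, y.2) (0, WithLp.toLp 2 w)
  rw [hX, hYZ] at e₃
  rw [hY, mul_zero, zero_mul] at e₄
  rw [hXY, mul_zero] at e₅
  have hprod : (deriv lam (energy g y) - mu (energy g y)) * (2 * energy g y) * (w ⬝ᵥ w) = 0 := by
    rw [← e₃]
    have z₁ : (0 : ℝ) = _ := e₁
    have z₂ : (0 : ℝ) = _ := e₂
    linarith
  have hww : w ⬝ᵥ w ≠ 0 := fun h0 => hw (dotProduct_self_eq_zero.1 h0)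
  have := (mul_eq_zero.1 ((mul_eq_zero.1 hprod).resolve_right hww)).resolve_right (by positivity)
  linarith

end Kaehler

/-! ### From coordinate domains to the manifold. -/

section Charts

variable {n : ℕ} {M : Type*} [TopologicalSpace M] [ChartedSpace (Coord n) M]

theorem inducedTarget_eq_phaseSet {e : OpenPartialHomeomorph M (Coord n)}
    (he : e ∈ IsManifold.maximalAtlas (𝓡 n) ∞ M) : inducedTarget e = phaseSet e.target :=
  Set.ext (mem_inducedTarget he)

theorem isMetricOn_metricMatrix [IsManifold (𝓡 n) ∞ M]
    (g : Bundle.ContMDiffRiemannianMetric (𝓡 n) ∞ (Coord n)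
      (fun x : M => TangentSpace (𝓡 n) x)) {e : OpenPartialHomeomorph M (Coord n)}
    (he : e ∈ IsManifold.maximalAtlas (𝓡 n) ∞ M) : IsMetricOn e.target (metricMatrix g e) where
  isOpen := e.open_target
  smooth := contDiffOn_metricMatrix g he
  symm := metricMatrix_symm g e
  pos _ hq _ hu := metricMatrix_pos g he hq hu

end Charts

theorem fundamentalForm_eq_sum {n : ℕ} {c : ℝ} {b₁ lam mu : ℝ → ℝ} {U : Set (Coord n)}
    {g : Coord n → Matrix (Fin n) (Fin n) ℝ} {y : PhaseCoord n}
    (h : AdmissibleCoefficients c b₁ lam mu) (hg : IsMetricOn U g) (hy : y ∈ phaseSet U)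
    (X Y : PhaseCoord n) :
    fundamentalForm (G c b₁ lam mu g) (J c b₁ g) y X Y =
      ∑ i, ∑ j, (lam (energy g y) * (if i = j then 1 else 0)
          + mu (energy g y) * raised g y i * y.2 j)
        * (Dp g y i X * dq j Y - Dp g y i Y * dq j X) := by
  have hM : ∀ i j, formMatrix lam mu g y i j = lam (energy g y) * (if i = j then 1 else 0)
      + mu (energy g y) * raised g y i * y.2 j := by
    intro i j
    simp [formMatrix, Matrix.one_apply, Matrix.vecMulVec_apply, mul_assoc]
  rw [fundamentalForm_eq h hg hy]
  simp only [dotProduct, Matrix.mulVec, hM, Finset.mul_sum, ← Finset.sum_sub_distrib, vertPart,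
    horizPart]
  exact Finset.sum_congr rfl fun i _ => Finset.sum_congr rfl fun j _ => by ring

end NaturalCotangent

end

theorem theorem7 {n : ℕ} (hn : 2 ≤ n) {M : Type*} [TopologicalSpace M] [Nonempty M]
    [ChartedSpace (EuclideanSpace ℝ (Fin n)) M] [IsManifold (𝓡 n) ∞ M]
    (g : Bundle.ContMDiffRiemannianMetric (𝓡 n) ∞ (EuclideanSpace ℝ (Fin n))
      (fun x : M => TangentSpace (𝓡 n) x))
    (c : ℝ) (hc : 0 < c) (hg : NaturalCotangent.HasConstantSectionalCurvature g c)
    (b₁ lam mu : ℝ → ℝ)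
    (hb₁ : ContDiffOn ℝ ∞ b₁ (Set.Ioi 0)) (hlam : ContDiffOn ℝ ∞ lam (Set.Ioi 0))
    (hmu : ContDiffOn ℝ ∞ mu (Set.Ioi 0))
    (hb₁_gt : ∀ t, 0 < t → -√(c / (2 * t)) < b₁ t)
    (hlam_pos : ∀ t, 0 < t → 0 < lam t)
    (hlam_mu : ∀ t, 0 < t → 0 < lam t + 2 * t * mu t) :
    NaturalCotangent.IsHermitian g c b₁ lam mu ∧
    (∀ e ∈ IsManifold.maximalAtlas (𝓡 n) ∞ M,
      ∀ y ∈ NaturalCotangent.inducedTarget e, ∀ X Y : NaturalCotangent.PhaseCoord n,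
        NaturalCotangent.fundamentalForm
            (NaturalCotangent.G c b₁ lam mu (NaturalCotangent.metricMatrix g e))
            (NaturalCotangent.J c b₁ (NaturalCotangent.metricMatrix g e)) y X Y =
          ∑ i, ∑ j,
            (lam (NaturalCotangent.energy (NaturalCotangent.metricMatrix g e) y)
                * (if i = j then 1 else 0)
              + mu (NaturalCotangent.energy (NaturalCotangent.metricMatrix g e) y)
                * NaturalCotangent.raised (NaturalCotangent.metricMatrix g e) y i * y.2 j)
            * (NaturalCotangent.Dp (NaturalCotangent.metricMatrix g e) y i X
                  * NaturalCotangent.dq j Y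
                - NaturalCotangent.Dp (NaturalCotangent.metricMatrix g e) y i Y
                  * NaturalCotangent.dq j X)) ∧
    (NaturalCotangent.IsKaehler g c b₁ lam mu ↔ ∀ t, 0 < t → mu t = deriv lam t) := by
  have h : NaturalCotangent.AdmissibleCoefficients c b₁ lam mu :=
    ⟨hc, hb₁, hlam, hmu, hb₁_gt, hlam_pos, hlam_mu⟩
  have hherm : NaturalCotangent.IsHermitian g c b₁ lam mu := by
    intro e he
    rw [NaturalCotangent.inducedTarget_eq_phaseSet he]
    exact NaturalCotangent.isHermitianOn h (NaturalCotangent.isMetricOn_metricMatrix g he)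
      (hg e he)
  refine ⟨hherm, fun e he y hy X Y => ?_, fun hK t ht => ?_, fun hml => ⟨hherm, fun e he => ?_⟩⟩
  · rw [NaturalCotangent.inducedTarget_eq_phaseSet he] at hy
    exact NaturalCotangent.fundamentalForm_eq_sum h
      (NaturalCotangent.isMetricOn_metricMatrix g he) hy X Y
  -- One chart is enough, since every positive value of `t` already occurs over it.
  · obtain ⟨x⟩ := ‹Nonempty M›
    have he : chartAt (EuclideanSpace ℝ (Fin n)) x ∈ IsManifold.maximalAtlas (𝓡 n) ∞ M :=
      IsManifold.chart_mem_maximalAtlas x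
    have hφ := hK.2 _ he
    rw [NaturalCotangent.inducedTarget_eq_phaseSet he] at hφ
    exact NaturalCotangent.mu_eq_deriv_lam hn h (NaturalCotangent.isMetricOn_metricMatrix g he)
      ⟨_, mem_chart_target _ x⟩ hφ ht
  · rw [NaturalCotangent.inducedTarget_eq_phaseSet he]
    exact NaturalCotangent.isClosedTwoFormOn h (NaturalCotangent.isMetricOn_metricMatrix g he) hml
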